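/- Let $\mathbb F$ be a field of characteristic different from $2$. **Trialities.** A *triality* is a finite-dimensional $\mathbb F$-vector space $V$ with a non-degenerate symmetric bilinear form $g$, three pairwise orthogonal subspaces $V_1,V_2,V_3$ with $V=V_1\oplus V_2\oplus V_3$ whose dimensions agree in $\mathbb F$, and a symmetric trilinear form $\tau$ on $V$ that vanishes on $V_s\times V_t\times V_u$ unless $s,t,u$ are pairwise distinct, such that the bilinear commutative product $xy$ defined by $g(xy,z)=\tau(x,y,z)$ for all $z$ satisfies $x(xy)=g(x,x)\,y$ whenever $s,t,u$ are pairwise distinct, $y\in V_t$ and $x\in V_s+V_u$. It has *dimension* $n$ if $\dim V_s=n$ for all $s$. Its *triality algebra* $\mathfrak T$ is the Lie algebra of all endomorphisms $D$ of $V$ preserving each $V_s$, skew for $g$, with $\tau(Dx,y,z)+\tau(x,Dy,z)+\tau(x,y,Dz)=0$. For $x,y$ in the same summand put $$B_{x,y}z=\tfrac12\big(g(y,z)x-g(x,z)y\big)+\tfrac18\big(x(yz)-y(xz)\big).$$ **The bracket.** Let two trialities of dimensions $n$ and $n'$ be given, with primes marking the objects of the second, and let $\kappa\in\mathbb F$.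 Indices are taken modulo $3$. Let $E=O\oplus O'\oplus U$ with $$O=\bigoplus_s V_s\otimes V_s,\qquad O'=\bigoplus_s V'_s\otimes V'_s,\qquad U=(V_1\otimes V'_2)\oplus(V_2\otimes V'_3)\oplus(V_3\otimes V'_1).$$ For $x,y\in V_s$ write $o(x,y)=x\otimes y\in O$, and similarly $o'(u,v)\in O'$; put $o(x,y)=0$, respectively $o'(u,v)=0$, if the arguments lie in different summands. Let $[\cdot,\cdot]_\kappa$ be the bilinear operation on $E$ given on these generators as follows, where $x,y\in V_s$ and $z,w\in V_t$ in the first three items, and $x\otimes u$ and $y\otimes v$ denote elements of $U$ in the indicated sectors in the last two. * $[O,O']_\kappa=[O',O]_\kappa=0$. * $[o(x,y),o(z,w)]_\kappa=\kappa\big(o(B_{x,y}z,w)+o(z,B_{x,y}w)\big)$, and likewise for $O'$. * $[o(x,y),z\otimes u]_\kappa=\kappa\,(B_{x,y}z)\otimes u=-[z\otimes u,o(x,y)]_\kappa$ for $u\in V'_{t+1}$, and likewise for $o'$ acting on the second tensor factor. * $[x\otimes u,y\otimes v]_\kappa=g'(u,v)\,o(x,y)+g(x,y)\,o'(u,v)$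 within one sector $V_s\otimes V'_{s+1}$. * $[x\otimes u,y\otimes v]_\kappa=xy\otimes uv=-[y\otimes v,x\otimes u]_\kappa$ for $x\otimes u\in V_s\otimes V'_{s+1}$ and $y\otimes v\in V_{s+1}\otimes V'_{s+2}$. Let $N\subset O$ be the span of the elements $o(x,y)+o(y,x)$ with $x,y\in V_s$ (skew-symmetry of the orthogonal generators) and of the elements $$o(x,yz)+o(y,zx)+o(z,xy),\qquad x\in V_1,\ y\in V_2,\ z\in V_3$$ (the triality constraint). Define $N'\subset O'$ likewise, and let $R=N\oplus N'\oplus 0\subset E$. **Theorem.** 1. For every $\kappa$ the bracket is consistent with the relations, that is, $[R,E]_\kappa\subset R$ and $[E,R]_\kappa\subset R$; hence it is well defined on $E/R$. 2. For every $\kappa$ and every $a\in E$ one has $[a,a]_\kappa\in R$; hence the bracket on $E/R$ is skew-symmetric. 3. For $\kappa=-8$ the bracket on $E/R$ satisfies the Jacobi identity, so $\mathfrak g=E/R$ is a Lie algebra. 4. $\dim\mathfrak g=3nn'+\dim\mathfrak T+\dim\mathfrak T'$. 5. Suppose that $\mathbb F$ has characteristic zero. Then there are injective Lie algebra homomorphisms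 $\mathfrak T\to\mathfrak g$ and $\mathfrak T'\to\mathfrak g$ whose images are the images of $O$ and $O'$ in $\mathfrak g$, and under which $D\in\mathfrak T$ and $D'\in\mathfrak T'$ act on the tensor sectors by $x\otimes u\mapsto Dx\otimes u$ and $x\otimes u\mapsto x\otimes D'u$. Moreover, if $n\in\{0,1,2,4,8\}$ then $\dim\mathfrak T=\tau_n$, and if $n'\in\{0,1,2,4,8\}$ then $\dim\mathfrak T'=\tau_{n'}$, where $\tau_0=\tau_1=0$, $\tau_2=2$, $\tau_4=9$, $\tau_8=28$. So if $n$ and $n'$ are both in this set, then $\dim\mathfrak g=3nn'+\tau_n+\tau_{n'}$. -/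

import Mathlib

open scoped TensorProduct

universe u v w

-- an associative ring is a Lie ring with the commutator as bracket
attribute [local instance] LieRing.ofAssociativeRing

/-- The data underlying a triality: a vector space `V` over `F` with a metric, an orthogonal
decomposition into three subspaces (indexed by `Fin 3`) whose dimensions agree in `F`, and a
symmetric trilinear form which vanishes unless its arguments lie in three different summands. -/
structure TrilinearData (F : Type*) (V : Type*) [Field F] [AddCommGroup V] [Module F V] where
  space : Fin 3 → Submodule F V
  metric : LinearMap.BilinForm F V
  form : V →ₗ[F] V →ₗ[F] V →ₗ[F] F
  metric_symm : ∀ x y, metric x y = metric y x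
  metric_nondegenerate : metric.Nondegenerate
  space_inf : ∀ s t, s ≠ t → space s ⊓ space t = ⊥
  space_sup : ⨆ s, space s = ⊤
  space_orthogonal : ∀ s t, s ≠ t → ∀ x ∈ space s, ∀ y ∈ space t, metric x y = 0
  dim_eq : ∀ s t, (Module.finrank F (space s) : F) = (Module.finrank F (space t) : F)
  form_swap_left : ∀ x y z, form x y z = form y x z
  form_swap_right : ∀ x y z, form x y z = form x z y
  form_vanish : ∀ s t u, ¬ (s ≠ t ∧ t ≠ u ∧ s ≠ u) →
    ∀ x ∈ space s, ∀ y ∈ space t, ∀ z ∈ space u, form x y z = 0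

namespace TrilinearData

variable {F V : Type*} [Field F] [AddCommGroup V] [Module F V]

/-- The three subspaces form an internal direct sum. -/
theorem isInternal (T : TrilinearData F V) : DirectSum.IsInternal T.space := by
  refine DirectSum.isInternal_submodule_of_iSupIndep_of_iSup_eq_top ?_ T.space_sup
  intro s
  rw [Submodule.disjoint_def]
  intro x hx hx'
  have key : ∀ y, T.metric x y = 0 := by
    intro y
    have hy : y ∈ ⨆ t, T.space t := by rw [T.space_sup]; trivial
    have hle : (⨆ t, T.space t) ≤ LinearMap.ker (T.metric x) := by
      refine iSup_le fun t y hy => ?_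
      rw [LinearMap.mem_ker]
      by_cases h : s = t
      · subst h
        have hle2 : (⨆ j, ⨆ (_ : j ≠ s), T.space j) ≤ LinearMap.ker (T.metric y) := by
          refine iSup_le fun j => iSup_le fun hj z hz => ?_
          rw [LinearMap.mem_ker]
          exact T.space_orthogonal s j (Ne.symm hj) y hy z hz
        rw [T.metric_symm]
        exact LinearMap.mem_ker.1 (hle2 hx')
      · exact T.space_orthogonal s t h x hx y hy
    exact LinearMap.mem_ker.1 (hle hy)
  exact T.metric_nondegenerate.1 x key

/-- The projection onto the `s`-th summand of the decomposition. -/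
noncomputable def proj (T : TrilinearData F V) (s : Fin 3) : V →ₗ[F] T.space s :=
  DirectSum.component F (Fin 3) (fun t => T.space t) s ∘ₗ
    (LinearEquiv.ofBijective (DirectSum.coeLinearMap T.space) T.isInternal).symm.toLinearMap

/-- The product `xy` on `V`, determined by `form x y z = metric (xy) z` for all `z`. -/
noncomputable def mul [FiniteDimensional F V] (T : TrilinearData F V) : V →ₗ[F] V →ₗ[F] V :=
  T.form.compr₂ (LinearMap.BilinForm.toDual T.metric T.metric_nondegenerate).symm.toLinearMap

theorem metric_mul [FiniteDimensional F V] (T : TrilinearData F V) (x y z : V) :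
    T.metric (T.mul x y) z = T.form x y z := by
  rw [← LinearMap.BilinForm.toDual_def T.metric_nondegenerate]
  simp [mul]

end TrilinearData

/-- A triality: trilinear data of Clifford algebra type. -/
structure Triality (F : Type*) (V : Type*) [Field F] [AddCommGroup V] [Module F V]
    [FiniteDimensional F V] extends TrilinearData F V where
  clifford : ∀ s t u : Fin 3, s ≠ t → t ≠ u → s ≠ u →
    ∀ y ∈ toTrilinearData.space t,
    ∀ x ∈ toTrilinearData.space s ⊔ toTrilinearData.space u,
    toTrilinearData.mul x (toTrilinearData.mul x y) = toTrilinearData.metric x x • y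

namespace Triality

variable {F V W : Type*} [Field F] [AddCommGroup V] [Module F V] [FiniteDimensional F V]
  [AddCommGroup W] [Module F W] [FiniteDimensional F W]

/-- The triality algebra: endomorphisms of `V` which preserve the three summands, are skew for the
metric, and annihilate the trilinear form. (Equivalently, triples of elements of the orthogonal
algebras of the three summands which satisfy the triality constraint.) -/
def algebra (T : Triality F V) : LieSubalgebra F (Module.End F V) where
  carrier := {D | (∀ s, ∀ x ∈ T.space s, D x ∈ T.space s) ∧
    (∀ x y, T.metric (D x) y + T.metric x (D y) = 0) ∧
    (∀ x y z, T.form (D x) y z + T.form x (D y) z + T.form x y (D z) = 0)}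
  zero_mem' := by simp
  add_mem' := by
    rintro D E ⟨h1, h2, h3⟩ ⟨k1, k2, k3⟩
    refine ⟨fun s x hx => add_mem (h1 s x hx) (k1 s x hx), fun x y => ?_, fun x y z => ?_⟩
    · simp only [LinearMap.add_apply, map_add]
      linear_combination h2 x y + k2 x y
    · simp only [LinearMap.add_apply, map_add]
      linear_combination h3 x y z + k3 x y z
  smul_mem' := by
    rintro c D ⟨h1, h2, h3⟩
    refine ⟨fun s x hx => Submodule.smul_mem _ c (h1 s x hx), fun x y => ?_, fun x y z => ?_⟩
    · simp only [LinearMap.smul_apply, map_smul, smul_eq_mul]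
      linear_combination c * h2 x y
    · simp only [LinearMap.smul_apply, map_smul, smul_eq_mul]
      linear_combination c * h3 x y z
  lie_mem' := by
    rintro D E ⟨h1, h2, h3⟩ ⟨k1, k2, k3⟩
    refine ⟨fun s x hx => sub_mem (h1 s _ (k1 s x hx)) (k1 s _ (h1 s x hx)), fun x y => ?_,
      fun x y z => ?_⟩
    · simp only [Ring.lie_def, LinearMap.sub_apply, Module.End.mul_apply, map_sub]
      linear_combination h2 (E x) y + h2 x (E y) - k2 (D x) y - k2 x (D y)
    · simp only [Ring.lie_def, LinearMap.sub_apply, Module.End.mul_apply, map_sub]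
      linear_combination h3 (E x) y z + h3 x (E y) z + h3 x y (E z)
        - k3 (D x) y z - k3 x (D y) z - k3 x y (D z)

/-- The space carrying the three orthogonal generators: `⨁ₛ Vₛ ⊗ Vₛ`. The skew-symmetry of these
generators and the triality constraint on them are imposed by the submodule `relations`. -/
abbrev OrthGen (T : Triality F V) : Type _ :=
  ∀ s : Fin 3, T.space s ⊗[F] T.space s

/-- The space of the three tensor generators: `(V₀ ⊗ W₁) ⊕ (V₁ ⊗ W₂) ⊕ (V₂ ⊗ W₀)`. -/
abbrev TensorGen (T : Triality F V) (T' : Triality F W) : Type _ :=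
  ∀ s : Fin 3, T.space s ⊗[F] T'.space (s + 1)

/-- The orthogonal generator with arguments `x` and `y`. If `x` and `y` lie in the same summand
`Vₛ`, this is `x ⊗ y` in the `s`-th component; if they lie in different summands, it is zero. -/
noncomputable def orth (T : Triality F V) : V →ₗ[F] V →ₗ[F] T.OrthGen :=
  ∑ s, ((TensorProduct.mk F (T.space s) (T.space s)).compl₁₂ (T.proj s) (T.proj s)).compr₂
    (LinearMap.single F (fun s => T.space s ⊗[F] T.space s) s)

/-- The tensor generator with arguments `x` and `u`. If `x ∈ Vₛ` and `u ∈ Wₛ₊₁`, this is `x ⊗ u`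
in the `s`-th component. -/
noncomputable def tens (T : Triality F V) (T' : Triality F W) : V →ₗ[F] W →ₗ[F] T.TensorGen T' :=
  ∑ s, ((TensorProduct.mk F (T.space s) (T'.space (s + 1))).compl₁₂ (T.proj s)
    (T'.proj (s + 1))).compr₂
      (LinearMap.single F (fun s => T.space s ⊗[F] T'.space (s + 1)) s)

/-- The inclusion of `⨁ₛ Vₛ ⊗ Vₛ` in `V ⊗ V`. -/
noncomputable def orthIncl (T : Triality F V) : T.OrthGen →ₗ[F] V ⊗[F] V :=
  ∑ s, TensorProduct.map (T.space s).subtype (T.space s).subtype ∘ₗ LinearMap.proj s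

/-- The inclusion of the `s`-th tensor sector in `V ⊗ W`. -/
noncomputable def sector (T : Triality F V) (T' : Triality F W) (s : Fin 3) :
    T.TensorGen T' →ₗ[F] V ⊗[F] W :=
  TensorProduct.map (T.space s).subtype (T'.space (s + 1)).subtype ∘ₗ LinearMap.proj s

/-- The inclusion of the tensor generators in `V ⊗ W`. -/
noncomputable def tensIncl (T : Triality F V) (T' : Triality F W) : T.TensorGen T' →ₗ[F] V ⊗[F] W :=
  ∑ s, T.sector T' s

/-- The box tensor, as an operator `z ↦ box x y z`, for `x` and `y` in the same summand `Vₛ`: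
`box x y z = ½ (g(y,z) x - g(x,z) y) + ⅛ (x(yz) - y(xz))`.
For `z ∈ Vₛ` the products vanish and this is the idempotent skew-symmetrizer (diagonal box); for `z`
in another summand the metric terms vanish and this is the off-diagonal box, since
`g(w, x(yz)) = g(xw, yz)`. -/
noncomputable def box (T : Triality F V) : V →ₗ[F] V →ₗ[F] Module.End F V :=
  LinearMap.mk₂ F
    (fun x y =>
      (2⁻¹ : F) • ((T.metric y).smulRight x - (T.metric x).smulRight y) +
      (8⁻¹ : F) • (T.mul x ∘ₗ T.mul y - T.mul y ∘ₗ T.mul x))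
    (by intros; ext; simp; module) (by intros; ext; simp; module)
    (by intros; ext; simp; module) (by intros; ext; simp; module)

/-- The box operator attached to an element of the space of orthogonal generators. -/
noncomputable def act (T : Triality F V) : T.OrthGen →ₗ[F] Module.End F V :=
  TensorProduct.lift T.box ∘ₗ T.orthIncl

/-- An endomorphism `P` of `V` acting on both arguments of an orthogonal generator:
`orth x y ↦ orth (P x) y + orth x (P y)`. -/
noncomputable def actOrth (T : Triality F V) (P : Module.End F V) : T.OrthGen →ₗ[F] T.OrthGen :=
  TensorProduct.lift T.orth ∘ₗ (LinearMap.rTensor V P + LinearMap.lTensor V P) ∘ₗ T.orthIncl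

/-- Endomorphisms `P` of `V` and `Q` of `W` acting on a tensor generator:
`tens x u ↦ tens (P x) u + tens x (Q u)`. -/
noncomputable def actTens (T : Triality F V) (T' : Triality F W) (P : Module.End F V) (Q : Module.End F W) :
    T.TensorGen T' →ₗ[F] T.TensorGen T' :=
  TensorProduct.lift (T.tens T') ∘ₗ (LinearMap.rTensor W P + LinearMap.lTensor V Q) ∘ₗ
    T.tensIncl T'

/-- `(x ⊗ u, y ⊗ v) ↦ g'(u,v) orth x y`. For arguments from different sectors this vanishes. -/
noncomputable def tensOrth (T : Triality F V) (T' : Triality F W) (a b : T.TensorGen T') : T.OrthGen :=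
  TensorProduct.rid F T.OrthGen
    (TensorProduct.map₂ T.orth T'.metric (T.tensIncl T' a) (T.tensIncl T' b))

/-- `(x ⊗ u, y ⊗ v) ↦ g(x,y) orth u v`. For arguments from different sectors this vanishes. -/
noncomputable def tensOrth' (T : Triality F V) (T' : Triality F W) (a b : T.TensorGen T') : T'.OrthGen :=
  TensorProduct.lid F T'.OrthGen
    (TensorProduct.map₂ T.metric T'.orth (T.tensIncl T' a) (T.tensIncl T' b))

/-- `(x ⊗ u, y ⊗ v) ↦ xy ⊗ uv` if the two arguments lie in the sectors `s` and `s + 1`, and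
`(x ⊗ u, y ⊗ v) ↦ - xy ⊗ uv` if they lie in the sectors `s + 1` and `s`. -/
noncomputable def tensTens (T : Triality F V) (T' : Triality F W) (a b : T.TensorGen T') : T.TensorGen T' :=
  TensorProduct.lift (T.tens T') (∑ s : Fin 3,
    (TensorProduct.map₂ T.mul T'.mul (T.sector T' s a) (T.sector T' (s + 1) b) -
      TensorProduct.map₂ T.mul T'.mul (T.sector T' (s + 1) a) (T.sector T' s b)))

/-- The space spanned by all generators, before the relations are imposed. -/
abbrev Gen (T : Triality F V) (T' : Triality F W) : Type _ :=
  T.OrthGen × T'.OrthGen × T.TensorGen T'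

/-- The bracket of the pair of trialities with constant `κ`. On generators:
* orthogonal generators of the two different trialities commute;
* `[orth x y, orth z w] = κ (orth (box x y z) w + orth z (box x y w))`, for each triality;
* `[orth x y, z ⊗ u] = κ (box x y z) ⊗ u = - [z ⊗ u, orth x y]`, and likewise for the second
  triality on the second factor;
* `[x ⊗ u, y ⊗ v] = g'(u,v) orth x y + g(x,y) orth u v` within one tensor sector;
* `[x ⊗ u, y ⊗ v] = xy ⊗ uv = - [y ⊗ v, x ⊗ u]` for `x ⊗ u` in sector `s`, `y ⊗ v` in sector
  `s + 1`. -/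
noncomputable def bracket (T : Triality F V) (T' : Triality F W) (κ : F) :
    T.Gen T' →ₗ[F] T.Gen T' →ₗ[F] T.Gen T' :=
  LinearMap.mk₂ F
    (fun a b =>
      (κ • T.actOrth (T.act a.1) b.1 + T.tensOrth T' a.2.2 b.2.2,
       κ • T'.actOrth (T'.act a.2.1) b.2.1 + T.tensOrth' T' a.2.2 b.2.2,
       κ • T.actTens T' (T.act a.1) (T'.act a.2.1) b.2.2
         - κ • T.actTens T' (T.act b.1) (T'.act b.2.1) a.2.2
         + T.tensTens T' a.2.2 b.2.2))
    (fun a a' b => by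
      ext1
      · simp [actOrth, tensOrth, LinearMap.rTensor_add, LinearMap.lTensor_add]; abel
      ext1
      · simp [actOrth, tensOrth', LinearMap.rTensor_add, LinearMap.lTensor_add]; abel
      · simp [actTens, tensTens, LinearMap.rTensor_add, LinearMap.lTensor_add, Fin.sum_univ_three]
        abel)
    (fun c a b => by
      ext1
      · simp [actOrth, tensOrth, LinearMap.rTensor_smul, LinearMap.lTensor_smul]; module
      ext1
      · simp [actOrth, tensOrth', LinearMap.rTensor_smul, LinearMap.lTensor_smul]; module
      · simp [actTens, tensTens, LinearMap.rTensor_smul, LinearMap.lTensor_smul,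
          Fin.sum_univ_three]
        module)
    (fun a b b' => by
      ext1
      · simp [actOrth, tensOrth]; abel
      ext1
      · simp [actOrth, tensOrth']; abel
      · simp [actTens, tensTens, LinearMap.rTensor_add, LinearMap.lTensor_add, Fin.sum_univ_three]
        abel)
    (fun c a b => by
      ext1
      · simp [actOrth, tensOrth]; module
      ext1
      · simp [actOrth, tensOrth']; module
      · simp [actTens, tensTens, LinearMap.rTensor_smul, LinearMap.lTensor_smul,
          Fin.sum_univ_three]
        module)

/-- The relations on the orthogonal generators of one triality: skew-symmetry, and the triality
constraint `orth x (yz) + orth y (zx) + orth z (xy) = 0` for `x ∈ V₀`, `y ∈ V₁`, `z ∈ V₂`.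
(In indices, with `form` the triality tensor `τ`, the latter is
`o_{ad} τ_{dbc} + o_{bd} τ_{adc} + o_{cd} τ_{abd} = 0`.) -/
def orthRelations (T : Triality F V) : Submodule F T.OrthGen :=
  Submodule.span F
    ({r | ∃ s, ∃ x ∈ T.space s, ∃ y ∈ T.space s, r = T.orth x y + T.orth y x} ∪
     {r | ∃ x ∈ T.space 0, ∃ y ∈ T.space 1, ∃ z ∈ T.space 2,
        r = T.orth x (T.mul y z) + T.orth y (T.mul z x) + T.orth z (T.mul x y)})

/-- The relations imposed on all generators of the pair of trialities. -/
def relations (T : Triality F V) (T' : Triality F W) : Submodule F (T.Gen T') :=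
  T.orthRelations.prod (T'.orthRelations.prod ⊥)

end Triality

/-- The dimensions `τ₀ = τ₁ = 0`, `τ₂ = 2`, `τ₄ = 9`, `τ₈ = 28`. -/
def tau : ℕ → ℕ
  | 2 => 2
  | 4 => 9
  | 8 => 28
  | _ => 0

/-! The argument rests on the pairing `pair`, sending `D` and `orth x y` to g(Dx, y). A functional
on O is the same as an endomorphism preserving the summands; it kills the skew relations iff the
endomorphism is g-skew, and the triality constraint iff the endomorphism satisfies the Leibniz rule
for τ. So N is exactly the annihilator of 𝔗 (`mem_orthRelations_iff`), O/N is dual to 𝔗, and the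
dimension formula follows.

The box operators lie in 𝔗 (`box_mem_algebra`) and g(B_{x,y}z, w) is symmetric under exchange of the
pairs (x, y) and (z, w). Hence ⟨act ξ, η⟩ is a symmetric 𝔗-invariant form on O. Symmetry shows that
N acts by zero; with invariance it makes the bracket on O skew modulo N.

For the Jacobi identity, an orthogonal generator brackets as κ times a derivation
(`actGen_bracket`), so only triples of tensor generators remain. In one sector the diagonal boxes of
the two trialities cancel each other; in three different sectors the triality constraint is what is
needed. Both hold for every κ. With two arguments in one sector and one in another, the Clifford
relation makes the double products cancel the off-diagonal boxes with their factor ⅛, provided κ =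
-8 (`jacobiator_pair`).

In characteristic zero O/N is identified with 𝔗 itself. If ξ corresponds under the metric to D ∈ 𝔗,
then act ξ = ((n + 4)/4) D, by a trace computation (`act_eq_smul_toEnd`). So `act` maps O onto 𝔗
with kernel N, and comparing traces of the two composites of `act` and `ofEnd` gives (n + 4) dim 𝔗 =
6n(n - 1), whence the numbers τ. -/

theorem Fin.exists_third {s t : Fin 3} (h : s ≠ t) : ∃ u : Fin 3, s ≠ u ∧ t ≠ u := by
  revert s t; decide

/-! ### The orthogonal decomposition and the product -/

namespace TrilinearData

variable {F V : Type*} [Field F] [AddCommGroup V] [Module F V]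

theorem proj_coe (T : TrilinearData F V) (s : Fin 3) (x : T.space s) : T.proj s (x : V) = x := by
  have h : (LinearEquiv.ofBijective (DirectSum.coeLinearMap T.space) T.isInternal).symm (x : V) =
      DirectSum.lof F (Fin 3) (fun t => T.space t) s x := by
    exact (LinearEquiv.symm_apply_eq _).2 (DirectSum.coeLinearMap_lof T.space s x).symm
  rw [proj, LinearMap.comp_apply, LinearEquiv.coe_coe, h, DirectSum.component.lof_self]

theorem proj_of_mem_ne (T : TrilinearData F V) {s t : Fin 3} (h : s ≠ t) {x : V}
    (hx : x ∈ T.space s) : T.proj t x = 0 := by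
  have h' : (LinearEquiv.ofBijective (DirectSum.coeLinearMap T.space) T.isInternal).symm x =
      DirectSum.lof F (Fin 3) (fun t => T.space t) s ⟨x, hx⟩ := by
    exact (LinearEquiv.symm_apply_eq _).2 (DirectSum.coeLinearMap_lof T.space s ⟨x, hx⟩).symm
  rw [proj, LinearMap.comp_apply, LinearEquiv.coe_coe, h', DirectSum.component.of]
  simp [h]

theorem proj_of_mem (T : TrilinearData F V) {s : Fin 3} {x : V} (hx : x ∈ T.space s) :
    T.proj s x = ⟨x, hx⟩ :=
  T.proj_coe s ⟨x, hx⟩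

/-- Linear maps which agree on the three summands are equal. -/
theorem hom_ext (T : TrilinearData F V) {M : Type*} [AddCommGroup M] [Module F M]
    {f h : V →ₗ[F] M} (H : ∀ s, ∀ x ∈ T.space s, f x = h x) : f = h := by
  have hle : (⨆ s, T.space s) ≤ LinearMap.eqLocus f h := iSup_le fun s x hx => H s x hx
  ext x
  exact hle (by rw [T.space_sup]; trivial)

theorem sum_proj (T : TrilinearData F V) : ∑ s, (T.space s).subtype ∘ₗ T.proj s = LinearMap.id := by
  refine T.hom_ext fun s x hx => ?_
  rw [LinearMap.sum_apply, Finset.sum_eq_single s]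
  · simp [T.proj_of_mem hx]
  · intro t _ h
    simp [T.proj_of_mem_ne h.symm hx]
  · simp

theorem eq_of_metric (T : TrilinearData F V) {x y : V} (h : ∀ z, T.metric x z = T.metric y z) :
    x = y := by
  rw [← sub_eq_zero]
  refine T.metric_nondegenerate.1 _ fun z => ?_
  simp [h]

/-- Both `x` and its `s`-component are orthogonal to the other summands, and they pair equally with
the `s`-th one, so nondegeneracy identifies them. -/
theorem mem_space_of_metric (T : TrilinearData F V) {s : Fin 3} {x : V}
    (h : ∀ t, s ≠ t → ∀ y ∈ T.space t, T.metric x y = 0) : x ∈ T.space s := by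
  have hx : x = T.proj s x := by
    refine T.eq_of_metric fun z => ?_
    refine LinearMap.congr_fun (T.hom_ext (f := T.metric x) (h := T.metric (T.proj s x))
      fun t y hy => ?_) z
    by_cases hst : s = t
    · subst hst
      have hsum := LinearMap.congr_fun T.sum_proj x
      rw [LinearMap.sum_apply, LinearMap.id_apply] at hsum
      conv_lhs => rw [← hsum]
      rw [map_sum, LinearMap.sum_apply, Finset.sum_eq_single s]
      · rfl
      · intro t _ hts
        exact T.space_orthogonal t s hts _ (T.proj t x).2 y hy
      · simp
    · rw [h t hst y hy, T.space_orthogonal s t hst _ (T.proj s x).2 y hy]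
  rw [hx]
  exact (T.proj s x).2

/-- The Leibniz rule for the trilinear form may be checked on the three summands. -/
theorem form_leibniz_of_space (T : TrilinearData F V) {D : Module.End F V}
    (hD : ∀ s, ∀ x ∈ T.space s, D x ∈ T.space s)
    (h : ∀ x ∈ T.space 0, ∀ y ∈ T.space 1, ∀ z ∈ T.space 2,
      T.form (D x) y z + T.form x (D y) z + T.form x y (D z) = 0) (x y z : V) :
    T.form (D x) y z + T.form x (D y) z + T.form x y (D z) = 0 := by
  -- The Leibniz defect is again a symmetric trilinear form, and vanishes on repeated summands
  -- because `D` preserves them; one ordering of the three summands therefore decides.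
  let L : V →ₗ[F] V →ₗ[F] V →ₗ[F] F :=
    T.form ∘ₗ D + T.form.compl₂ D + T.form.compr₂ (LinearMap.lcomp F F D)
  have hL : ∀ x y z, L x y z = T.form (D x) y z + T.form x (D y) z + T.form x y (D z) :=
    fun x y z => by simp [L]
  have s1 : ∀ x y z, L x y z = L y x z := fun x y z => by
    rw [hL, hL, T.form_swap_left (D x), T.form_swap_left x (D y), T.form_swap_left x y]
    ring
  have s2 : ∀ x y z, L x y z = L x z y := fun x y z => by
    rw [hL, hL, T.form_swap_right (D x), T.form_swap_right x (D y), T.form_swap_right x y]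
    ring
  suffices H : L = 0 by rw [← hL, H]; rfl
  refine T.hom_ext fun s x hx => T.hom_ext fun t y hy => T.hom_ext fun u z hz => ?_
  change L x y z = 0
  by_cases hd : s ≠ t ∧ t ≠ u ∧ s ≠ u
  · have h' : ∀ x ∈ T.space 0, ∀ y ∈ T.space 1, ∀ z ∈ T.space 2, L x y z = 0 :=
      fun x hx y hy z hz => by rw [hL]; exact h x hx y hy z hz
    fin_cases s <;> fin_cases t <;> fin_cases u <;> simp at hd
    · exact h' x hx y hy z hz
    · rw [s2]; exact h' x hx z hz y hy
    · rw [s1]; exact h' y hy x hx z hz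
    · rw [s2, s1]; exact h' z hz x hx y hy
    · rw [s1, s2]; exact h' y hy z hz x hx
    · rw [s1, s2, s1]; exact h' z hz y hy x hx
  · rw [hL, T.form_vanish s t u hd _ (hD s x hx) y hy z hz,
      T.form_vanish s t u hd x hx _ (hD t y hy) z hz,
      T.form_vanish s t u hd x hx y hy _ (hD u z hz)]
    ring

section Mul

variable [FiniteDimensional F V]

theorem mul_comm (T : TrilinearData F V) (x y : V) : T.mul x y = T.mul y x :=
  T.eq_of_metric fun z => by rw [metric_mul, metric_mul, T.form_swap_left]

theorem metric_mul' (T : TrilinearData F V) (x y z : V) :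
    T.metric x (T.mul y z) = T.form x y z := by
  rw [T.metric_symm, metric_mul, T.form_swap_right, T.form_swap_left]

/-- Multiplication operators are symmetric. -/
theorem metric_mul_right (T : TrilinearData F V) (x y z : V) :
    T.metric y (T.mul x z) = T.metric (T.mul x y) z := by
  rw [metric_mul, metric_mul', T.form_swap_left]

theorem mul_eq_zero (T : TrilinearData F V) {s : Fin 3} {x y : V} (hx : x ∈ T.space s)
    (hy : y ∈ T.space s) : T.mul x y = 0 := by
  refine T.eq_of_metric fun z => ?_
  rw [metric_mul, map_zero, LinearMap.zero_apply]
  refine LinearMap.congr_fun (T.hom_ext (f := T.form x y) (h := 0) fun u z hz => ?_) z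
  exact T.form_vanish s s u (by simp) x hx y hy z hz

/-- The product pairs to zero with every summand other than the `u`-th. The case `s = t` is
harmless, the product being zero there. -/
theorem mul_mem (T : TrilinearData F V) {s t u : Fin 3} (hsu : s ≠ u) (htu : t ≠ u)
    {x y : V} (hx : x ∈ T.space s) (hy : y ∈ T.space t) : T.mul x y ∈ T.space u := by
  refine T.mem_space_of_metric fun r hr z hz => ?_
  rw [metric_mul]
  refine T.form_vanish s t r ?_ x hx y hy z hz
  omega

end Mul

end TrilinearData

/-! ### The Clifford relation and the box operators as elements of 𝔗 -/

namespace Triality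

variable {F V W : Type*} [Field F] [AddCommGroup V] [Module F V] [FiniteDimensional F V]
  [AddCommGroup W] [Module F W] [FiniteDimensional F W]

theorem mul_mul_self (T : Triality F V) {s t : Fin 3} (hst : s ≠ t) {x y : V}
    (hx : x ∈ T.space s) (hy : y ∈ T.space t) : T.mul x (T.mul x y) = T.metric x x • y := by
  obtain ⟨u, hsu, htu⟩ := Fin.exists_third hst
  exact T.clifford s t u hst htu hsu y hy x (Submodule.mem_sup_left hx)

/-- The polarised Clifford relation. -/
theorem mul_mul_add (T : Triality F V) {s t : Fin 3} (hst : s ≠ t) {x y z : V}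
    (hx : x ∈ T.space s) (hy : y ∈ T.space s) (hz : z ∈ T.space t) :
    T.mul x (T.mul y z) + T.mul y (T.mul x z) = (2 * T.metric x y) • z := by
  have h := T.mul_mul_self hst (add_mem hx hy) hz
  simp only [map_add, LinearMap.add_apply, T.mul_mul_self hst hx hz, T.mul_mul_self hst hy hz,
    T.metric_symm y x] at h
  rw [← sub_eq_zero] at h ⊢
  rw [← h]
  module

theorem mul_mul_swap (T : Triality F V) {s t : Fin 3} (hst : s ≠ t) {x y z : V}
    (hx : x ∈ T.space s) (hy : y ∈ T.space s) (hz : z ∈ T.space t) :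
    T.mul y (T.mul x z) = (2 * T.metric x y) • z - T.mul x (T.mul y z) :=
  eq_sub_of_add_eq' (T.mul_mul_add hst hx hy hz)

theorem mem_algebra (T : Triality F V) {D : Module.End F V} :
    D ∈ T.algebra ↔ (∀ s, ∀ x ∈ T.space s, D x ∈ T.space s) ∧
    (∀ x y, T.metric (D x) y + T.metric x (D y) = 0) ∧
    (∀ x y z, T.form (D x) y z + T.form x (D y) z + T.form x y (D z) = 0) :=
  Iff.rfl

/-- Elements of the triality algebra are derivations of the product. -/
theorem apply_mul (T : Triality F V) {D : Module.End F V} (hD : D ∈ T.algebra) (x y : V) :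
    D (T.mul x y) = T.mul (D x) y + T.mul x (D y) := by
  refine T.eq_of_metric fun z => ?_
  have h1 := hD.2.1 (T.mul x y) z
  have h2 := hD.2.2 x y z
  rw [T.metric_mul] at h1
  rw [map_add, LinearMap.add_apply, T.metric_mul, T.metric_mul]
  linear_combination h1 - h2

theorem metric_apply (T : Triality F V) {D : Module.End F V} (hD : D ∈ T.algebra) (x y : V) :
    T.metric (D x) y = -T.metric x (D y) :=
  eq_neg_of_add_eq_zero_left (hD.2.1 x y)

theorem box_apply (T : Triality F V) (x y z : V) :
    T.box x y z = (2⁻¹ : F) • (T.metric y z • x - T.metric x z • y) +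
      (8⁻¹ : F) • (T.mul x (T.mul y z) - T.mul y (T.mul x z)) := by
  simp [box]

theorem metric_box (T : Triality F V) (x y z w : V) :
    T.metric (T.box x y z) w =
      2⁻¹ * (T.metric y z * T.metric x w - T.metric x z * T.metric y w) +
      8⁻¹ * (T.metric (T.mul y z) (T.mul x w) - T.metric (T.mul x z) (T.mul y w)) := by
  simp [box_apply, T.metric_mul_right]

/-- The pair symmetry familiar from curvature tensors. It is the source of the symmetric form on the
orthogonal generators. -/
theorem metric_box_symm (T : Triality F V) (x y z w : V) :
    T.metric (T.box x y z) w = T.metric (T.box z w x) y := by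
  rw [metric_box, metric_box, T.metric_symm w x, T.metric_symm z y, T.metric_symm z x,
    T.metric_symm w y, T.mul_comm w x, T.mul_comm z y, T.mul_comm z x, T.mul_comm w y,
    T.metric_symm (T.mul x w)]
  ring

theorem metric_box_skew (T : Triality F V) (x y z w : V) :
    T.metric (T.box x y z) w + T.metric z (T.box x y w) = 0 := by
  rw [T.metric_symm z, metric_box, metric_box, T.metric_symm (T.mul y w),
    T.metric_symm (T.mul x w)]
  ring

theorem box_mem (T : Triality F V) {s t : Fin 3} {x y z : V} (hx : x ∈ T.space s)
    (hy : y ∈ T.space s) (hz : z ∈ T.space t) : T.box x y z ∈ T.space t := by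
  rw [box_apply]
  by_cases hst : s = t
  · subst hst
    rw [T.mul_eq_zero hx hz, T.mul_eq_zero hy hz]
    simp only [map_zero, sub_zero, smul_zero, add_zero]
    exact Submodule.smul_mem _ _ (sub_mem (Submodule.smul_mem _ _ hx) (Submodule.smul_mem _ _ hy))
  · obtain ⟨u, hsu, htu⟩ := Fin.exists_third hst
    rw [T.space_orthogonal s t hst x hx z hz, T.space_orthogonal s t hst y hy z hz]
    simp only [zero_smul, sub_zero, smul_zero, zero_add]
    exact Submodule.smul_mem _ _ (sub_mem
      (T.mul_mem hst htu.symm hx (T.mul_mem hsu htu hy hz))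
      (T.mul_mem hst htu.symm hy (T.mul_mem hsu htu hx hz)))

/-- The box is built from the metric and the product alone, and `D` is skew for the one and a
derivation of the other. -/
theorem box_equivariant (T : Triality F V) {D : Module.End F V} (hD : D ∈ T.algebra) (x y : V) :
    ⁅D, T.box x y⁆ = T.box (D x) y + T.box x (D y) := by
  ext z
  rw [Ring.lie_def, LinearMap.sub_apply, Module.End.mul_apply, Module.End.mul_apply,
    LinearMap.add_apply, box_apply, box_apply, box_apply, box_apply]
  simp only [map_add, map_sub, map_smul, T.apply_mul hD, T.metric_apply hD]
  module

/-- On `w` in the summand of `x` the first box is diagonal and the other two are off-diagonal.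
Moving `x` outward by the Clifford relation cancels their remaining quartic products and leaves ⅛ ·
4 (g(x,w) yz - τ(w,y,z) x), which cancels the diagonal box with its coefficient ½. This fixes the
ratio of ½ to ⅛. -/
theorem box_constraint_aux (hF : (2 : F) ≠ 0) (T : Triality F V) {s t u : Fin 3} (hst : s ≠ t)
    (hsu : s ≠ u) (htu : t ≠ u) {x y z w : V} (hx : x ∈ T.space s) (hy : y ∈ T.space t)
    (hz : z ∈ T.space u) (hw : w ∈ T.space s) :
    T.box x (T.mul y z) w + T.box y (T.mul z x) w + T.box z (T.mul x y) w = 0 := by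
  have hyz : T.mul y z ∈ T.space s := T.mul_mem hst.symm hsu.symm hy hz
  have h8 : (8⁻¹ : F) * 4 = 2⁻¹ := by
    have : (8 : F) = 2 * 2 * 2 := by norm_num
    have h4 : (4 : F) = 2 * 2 := by norm_num
    rw [this, h4]; field_simp
  have e1 : T.mul y (T.mul (T.mul z x) w) = (2 * T.metric x w) • T.mul y z
      - ((2 * T.form w y z) • x - T.mul (T.mul w z) (T.mul x y)) := by
    rw [T.mul_comm (T.mul z x) w, T.mul_comm z x, T.mul_mul_swap hsu hx hw hz, map_sub, map_smul,
      T.mul_comm x (T.mul w z),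
      T.mul_mul_swap hst.symm (T.mul_mem hst htu.symm hw hz) hy hx, T.metric_mul,
      T.form_swap_right w z y, T.mul_comm y x]
  have e2 : T.mul z (T.mul (T.mul x y) w) = (2 * T.metric x w) • T.mul y z
      - ((2 * T.form w y z) • x - T.mul (T.mul w y) (T.mul z x)) := by
    rw [T.mul_comm (T.mul x y) w, T.mul_mul_swap hst hx hw hy, map_sub, map_smul,
      T.mul_comm x (T.mul w y),
      T.mul_mul_swap hsu.symm (T.mul_mem hsu htu hw hy) hz hx, T.metric_mul,
      T.mul_comm z y]
  rw [box_apply, box_apply, box_apply, e1, e2, T.mul_eq_zero hyz hw, T.mul_eq_zero hx hw,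
    T.space_orthogonal t s hst.symm y hy w hw, T.space_orthogonal u s hsu.symm z hz w hw,
    T.space_orthogonal t s hst.symm _ (T.mul_mem htu.symm hst hz hx) w hw,
    T.space_orthogonal u s hsu.symm _ (T.mul_mem hsu htu hx hy) w hw, T.metric_mul,
    T.mul_comm y w, T.mul_comm z w, T.mul_comm (T.mul x y) (T.mul w z),
    T.mul_comm (T.mul z x) (T.mul w y), ← h8, T.form_swap_right y z w, T.form_swap_left y w z]
  simp only [map_zero]
  module

/-- The box operators satisfy the triality constraint. -/
theorem box_constraint (hF : (2 : F) ≠ 0) (T : Triality F V) {x y z : V} (hx : x ∈ T.space 0)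
    (hy : y ∈ T.space 1) (hz : z ∈ T.space 2) :
    T.box x (T.mul y z) + T.box y (T.mul z x) + T.box z (T.mul x y) = 0 := by
  refine T.hom_ext fun s w hw => ?_
  simp only [LinearMap.add_apply, LinearMap.zero_apply]
  fin_cases s
  · exact T.box_constraint_aux hF (by decide) (by decide) (by decide) hx hy hz hw
  · rw [add_assoc, add_comm]
    exact T.box_constraint_aux hF (by decide) (by decide) (by decide) hy hz hx hw
  · rw [add_comm, ← add_assoc]
    exact T.box_constraint_aux hF (by decide) (by decide) (by decide) hz hx hy hw

/-- By the pair symmetry, the Leibniz rule for `box x y` at `(a, b, c)` is the box constraint for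
`(a, b, c)` evaluated at `x` and paired with `y`. -/
theorem box_mem_algebra (hF : (2 : F) ≠ 0) (T : Triality F V) {s : Fin 3} {x y : V}
    (hx : x ∈ T.space s) (hy : y ∈ T.space s) : T.box x y ∈ T.algebra := by
  have hB : ∀ t, ∀ z ∈ T.space t, T.box x y z ∈ T.space t := fun t z hz => T.box_mem hx hy hz
  refine T.mem_algebra.2 ⟨hB, T.metric_box_skew x y, T.form_leibniz_of_space hB ?_⟩
  intro a ha b hb c hc
  have h := LinearMap.congr_fun (congrArg T.metric
    (LinearMap.congr_fun (T.box_constraint hF ha hb hc) x)) y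
  simp only [LinearMap.add_apply, map_add, LinearMap.zero_apply, map_zero] at h
  rw [T.metric_box_symm, T.metric_box_symm b, T.metric_box_symm c, T.metric_mul', T.metric_mul',
    T.metric_mul'] at h
  rw [← h, T.form_swap_left a, T.form_swap_right _ a c, T.form_swap_right a b,
    T.form_swap_left a _ b]

end Triality

/-! ### Values of the constituents of the bracket on generators -/

namespace Triality

variable {F V W : Type*} [Field F] [AddCommGroup V] [Module F V] [FiniteDimensional F V]
  [AddCommGroup W] [Module F W] [FiniteDimensional F W]

section Generators

variable (T : Triality F V) (T' : Triality F W)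

theorem orth_of_mem {s : Fin 3} {x y : V} (hx : x ∈ T.space s) (hy : y ∈ T.space s) :
    T.orth x y = Pi.single s ((⟨x, hx⟩ : T.space s) ⊗ₜ[F] (⟨y, hy⟩ : T.space s)) := by
  rw [orth, LinearMap.sum_apply, LinearMap.sum_apply, Finset.sum_eq_single s]
  · simp [T.proj_of_mem hx, T.proj_of_mem hy]
  · intro t _ h
    simp [T.proj_of_mem_ne h.symm hx]
  · simp

theorem orth_of_mem_ne {s t : Fin 3} (hst : s ≠ t) {x y : V} (hx : x ∈ T.space s)
    (hy : y ∈ T.space t) : T.orth x y = 0 := by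
  rw [orth, LinearMap.sum_apply, LinearMap.sum_apply]
  refine Finset.sum_eq_zero fun r _ => ?_
  by_cases h : s = r
  · subst h
    simp [T.proj_of_mem_ne hst.symm hy]
  · simp [T.proj_of_mem_ne h hx]

theorem tens_of_mem {s : Fin 3} {x : V} {u : W} (hx : x ∈ T.space s) (hu : u ∈ T'.space (s + 1)) :
    T.tens T' x u =
      Pi.single s ((⟨x, hx⟩ : T.space s) ⊗ₜ[F] (⟨u, hu⟩ : T'.space (s + 1))) := by
  rw [tens, LinearMap.sum_apply, LinearMap.sum_apply, Finset.sum_eq_single s]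
  · simp [T.proj_of_mem hx, T'.proj_of_mem hu]
  · intro t _ h
    simp [T.proj_of_mem_ne h.symm hx]
  · simp

/-- Linear maps on the orthogonal generators are determined by their values on `orth x y`. -/
theorem orthGen_hom_ext {M : Type*} [AddCommGroup M] [Module F M] {f h : T.OrthGen →ₗ[F] M}
    (H : ∀ s, ∀ x ∈ T.space s, ∀ y ∈ T.space s, f (T.orth x y) = h (T.orth x y)) : f = h := by
  refine LinearMap.pi_ext' fun s => TensorProduct.ext' fun x y => ?_
  have := H s x x.2 y y.2
  rwa [T.orth_of_mem x.2 y.2] at this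

/-- Linear maps on the tensor generators are determined by their values on `tens x u`. -/
theorem tensGen_hom_ext {M : Type*} [AddCommGroup M] [Module F M] {f h : T.TensorGen T' →ₗ[F] M}
    (H : ∀ s, ∀ x ∈ T.space s, ∀ u ∈ T'.space (s + 1), f (T.tens T' x u) = h (T.tens T' x u)) :
    f = h := by
  refine LinearMap.pi_ext' fun s => TensorProduct.ext' fun x u => ?_
  have := H s x x.2 u u.2
  rwa [T.tens_of_mem T' x.2 u.2] at this

theorem orthIncl_orth {s : Fin 3} {x y : V} (hx : x ∈ T.space s) (hy : y ∈ T.space s) :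
    T.orthIncl (T.orth x y) = x ⊗ₜ y := by
  rw [T.orth_of_mem hx hy, orthIncl, LinearMap.sum_apply, Finset.sum_eq_single s]
  · simp
  · intro t _ h
    simp [h]
  · simp

theorem act_orth {s : Fin 3} {x y : V} (hx : x ∈ T.space s) (hy : y ∈ T.space s) :
    T.act (T.orth x y) = T.box x y := by
  rw [act, LinearMap.comp_apply, T.orthIncl_orth hx hy, TensorProduct.lift.tmul]

theorem actOrth_orth (P : Module.End F V) {s : Fin 3} {x y : V} (hx : x ∈ T.space s)
    (hy : y ∈ T.space s) : T.actOrth P (T.orth x y) = T.orth (P x) y + T.orth x (P y) := by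
  simp [actOrth, T.orthIncl_orth hx hy]

theorem sector_tens {s : Fin 3} {x : V} {u : W} (hx : x ∈ T.space s)
    (hu : u ∈ T'.space (s + 1)) : T.sector T' s (T.tens T' x u) = x ⊗ₜ u := by
  simp [sector, T.tens_of_mem T' hx hu]

theorem sector_tens_of_ne {s t : Fin 3} (hst : t ≠ s) {x : V} {u : W} (hx : x ∈ T.space s)
    (hu : u ∈ T'.space (s + 1)) : T.sector T' t (T.tens T' x u) = 0 := by
  simp [sector, T.tens_of_mem T' hx hu, hst]

theorem tensIncl_tens {s : Fin 3} {x : V} {u : W} (hx : x ∈ T.space s)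
    (hu : u ∈ T'.space (s + 1)) : T.tensIncl T' (T.tens T' x u) = x ⊗ₜ u := by
  rw [tensIncl, LinearMap.sum_apply, Finset.sum_eq_single s]
  · exact T.sector_tens T' hx hu
  · intro t _ h
    exact T.sector_tens_of_ne T' h hx hu
  · simp

theorem actTens_tens (P : Module.End F V) (Q : Module.End F W) {s : Fin 3} {x : V} {u : W}
    (hx : x ∈ T.space s) (hu : u ∈ T'.space (s + 1)) :
    T.actTens T' P Q (T.tens T' x u) = T.tens T' (P x) u + T.tens T' x (Q u) := by
  simp [actTens, T.tensIncl_tens T' hx hu]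

theorem tensOrth_tens {s t : Fin 3} {x y : V} {u v : W} (hx : x ∈ T.space s)
    (hu : u ∈ T'.space (s + 1)) (hy : y ∈ T.space t) (hv : v ∈ T'.space (t + 1)) :
    T.tensOrth T' (T.tens T' x u) (T.tens T' y v) = T'.metric u v • T.orth x y := by
  simp [tensOrth, T.tensIncl_tens T' hx hu, T.tensIncl_tens T' hy hv]

theorem tensOrth'_tens {s t : Fin 3} {x y : V} {u v : W} (hx : x ∈ T.space s)
    (hu : u ∈ T'.space (s + 1)) (hy : y ∈ T.space t) (hv : v ∈ T'.space (t + 1)) :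
    T.tensOrth' T' (T.tens T' x u) (T.tens T' y v) = T.metric x y • T'.orth u v := by
  simp [tensOrth', T.tensIncl_tens T' hx hu, T.tensIncl_tens T' hy hv]

theorem tensTens_tens_self {s : Fin 3} {x y : V} {u v : W} (hx : x ∈ T.space s)
    (hu : u ∈ T'.space (s + 1)) (hy : y ∈ T.space s) (hv : v ∈ T'.space (s + 1)) :
    T.tensTens T' (T.tens T' x u) (T.tens T' y v) = 0 := by
  have hs : ∀ r : Fin 3, r ≠ r + 1 := by decide
  rw [tensTens, Finset.sum_eq_zero, map_zero]
  intro r _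
  by_cases h : r = s
  · subst h
    simp [T.sector_tens_of_ne T' (hs r).symm hx hu, T.sector_tens_of_ne T' (hs r).symm hy hv]
  · simp [T.sector_tens_of_ne T' h hx hu, T.sector_tens_of_ne T' h hy hv]

theorem tensTens_tens_succ {s t : Fin 3} (hst : t = s + 1) {x y : V} {u v : W} (hx : x ∈ T.space s)
    (hu : u ∈ T'.space (s + 1)) (hy : y ∈ T.space t) (hv : v ∈ T'.space (t + 1)) :
    T.tensTens T' (T.tens T' x u) (T.tens T' y v) = T.tens T' (T.mul x y) (T'.mul u v) := by
  subst hst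
  have h1 : ∀ r : Fin 3, r + 1 ≠ r := by decide
  have h2 : ∀ s r : Fin 3, r ≠ s → r = s + 1 → r + 1 ≠ s := by decide
  rw [tensTens, Finset.sum_eq_single s]
  · simp [T.sector_tens T' hx hu, T.sector_tens T' hy hv, T.sector_tens_of_ne T' (h1 s) hx hu]
  · intro r _ hr
    -- At `r = s + 1` the subtracted term would need `x ⊗ u` in sector `s + 2`; for other `r ≠ s` it
    -- would need `y ⊗ v` in sector `r`.
    by_cases h : r = s + 1
    · simp [T.sector_tens_of_ne T' hr hx hu, T.sector_tens_of_ne T' (h2 s r hr h) hx hu]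
    · simp [T.sector_tens_of_ne T' hr hx hu, T.sector_tens_of_ne T' h hy hv]
  · simp

/-- The product on `V ⊗ W` is commutative because both factors are; the antisymmetry comes only from
the sign between consecutive sectors. -/
theorem tensTens_swap (a b : T.TensorGen T') : T.tensTens T' a b = -T.tensTens T' b a := by
  have hc : ∀ p q : V ⊗[F] W, TensorProduct.map₂ T.mul T'.mul p q =
      TensorProduct.map₂ T.mul T'.mul q p := by
    intro p q
    refine LinearMap.congr_fun₂ (f := TensorProduct.map₂ T.mul T'.mul)
      (g := (TensorProduct.map₂ T.mul T'.mul).flip) ?_ p q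
    refine TensorProduct.ext' fun x u => TensorProduct.ext' fun y v => ?_
    simp [T.mul_comm x y, T'.mul_comm u v]
  rw [tensTens, tensTens, ← map_neg, ← Finset.sum_neg_distrib]
  congr 1
  refine Finset.sum_congr rfl fun s _ => ?_
  rw [hc, hc (T.sector T' (s + 1) a)]
  abel

end Generators

end Triality

/-! ### Duality between the triality algebra and the orthogonal generators -/

namespace Triality

variable {F V W : Type*} [Field F] [AddCommGroup V] [Module F V] [FiniteDimensional F V]
  [AddCommGroup W] [Module F W] [FiniteDimensional F W]

section Pairing

variable (T : Triality F V)

/-- The pairing of endomorphisms with orthogonal generators, `⟨D, orth x y⟩ = g(Dx, y)`. -/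
noncomputable def pair : Module.End F V →ₗ[F] T.OrthGen →ₗ[F] F where
  toFun D := TensorProduct.lift (T.metric ∘ₗ D) ∘ₗ T.orthIncl
  map_add' D E := T.orthGen_hom_ext fun s x hx y hy => by simp [T.orthIncl_orth hx hy]
  map_smul' c D := T.orthGen_hom_ext fun s x hx y hy => by simp [T.orthIncl_orth hx hy]

theorem pair_orth (D : Module.End F V) {s : Fin 3} {x y : V} (hx : x ∈ T.space s)
    (hy : y ∈ T.space s) : T.pair D (T.orth x y) = T.metric (D x) y := by
  simp [pair, T.orthIncl_orth hx hy]

theorem act_mem_algebra (hF : (2 : F) ≠ 0) (ξ : T.OrthGen) : T.act ξ ∈ T.algebra := by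
  have h : T.algebra.toSubmodule.mkQ ∘ₗ T.act = 0 := T.orthGen_hom_ext fun s x hx y hy => by
    rw [LinearMap.comp_apply, T.act_orth hx hy, LinearMap.zero_apply, Submodule.mkQ_apply,
      Submodule.Quotient.mk_eq_zero]
    exact T.box_mem_algebra hF hx hy
  simpa using LinearMap.congr_fun h ξ

theorem pair_act_comm (ξ η : T.OrthGen) : T.pair (T.act ξ) η = T.pair (T.act η) ξ := by
  refine LinearMap.congr_fun₂ (f := T.pair ∘ₗ T.act) (g := (T.pair ∘ₗ T.act).flip)
    (T.orthGen_hom_ext fun s x hx y hy => T.orthGen_hom_ext fun t z hz w hw => ?_) ξ η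
  simp only [LinearMap.comp_apply, LinearMap.flip_apply]
  rw [T.act_orth hx hy, T.act_orth hz hw, T.pair_orth _ hx hy, T.pair_orth _ hz hw,
    T.metric_box_symm]

/-- Skewness of `P` moves it from the second argument of the metric to the first, which produces the
commutator. -/
theorem pair_actOrth {P : Module.End F V} (hP : P ∈ T.algebra) (D : Module.End F V)
    (ξ : T.OrthGen) : T.pair D (T.actOrth P ξ) = T.pair ⁅D, P⁆ ξ := by
  refine LinearMap.congr_fun (f := T.pair D ∘ₗ T.actOrth P) (T.orthGen_hom_ext
    fun s x hx y hy => ?_) ξ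
  rw [LinearMap.comp_apply, T.actOrth_orth P hx hy, map_add, T.pair_orth _ (hP.1 s x hx) hy,
    T.pair_orth _ hx (hP.1 s y hy), T.pair_orth _ hx hy, Ring.lie_def, LinearMap.sub_apply,
    Module.End.mul_apply, Module.End.mul_apply, map_sub, LinearMap.sub_apply, T.metric_apply hP,
    sub_neg_eq_add]

theorem act_actOrth {P : Module.End F V} (hP : P ∈ T.algebra) (ξ : T.OrthGen) :
    T.act (T.actOrth P ξ) = ⁅P, T.act ξ⁆ := by
  refine LinearMap.congr_fun (f := T.act ∘ₗ T.actOrth P)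
    (g := (LieModule.toEnd F (Module.End F V) (Module.End F V) P) ∘ₗ T.act)
    (T.orthGen_hom_ext fun s x hx y hy => ?_) ξ
  rw [LinearMap.comp_apply, T.actOrth_orth P hx hy, map_add, T.act_orth (hP.1 s x hx) hy,
    T.act_orth hx (hP.1 s y hy), LinearMap.comp_apply, T.act_orth hx hy, LieModule.toEnd_apply_apply,
    T.box_equivariant hP]

theorem pair_constraint {D : Module.End F V} (hD : D ∈ T.algebra) {x y z : V}
    (hx : x ∈ T.space 0) (hy : y ∈ T.space 1) (hz : z ∈ T.space 2) :
    T.pair D (T.orth x (T.mul y z) + T.orth y (T.mul z x) + T.orth z (T.mul x y)) = 0 := by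
  rw [map_add, map_add, T.pair_orth D hx (T.mul_mem (by decide) (by decide) hy hz),
    T.pair_orth D hy (T.mul_mem (by decide) (by decide) hz hx),
    T.pair_orth D hz (T.mul_mem (by decide) (by decide) hx hy), T.metric_mul', T.metric_mul',
    T.metric_mul', ← hD.2.2 x y z, T.form_swap_left x, T.form_swap_right _ z x,
    T.form_swap_right x y, T.form_swap_left x]

theorem pair_eq_zero_of_mem {D : Module.End F V} (hD : D ∈ T.algebra) {ξ : T.OrthGen}
    (hξ : ξ ∈ T.orthRelations) : T.pair D ξ = 0 := by
  refine (Submodule.span_le (p := LinearMap.ker (T.pair D))).2 ?_ hξ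
  rintro r (⟨s, x, hx, y, hy, rfl⟩ | ⟨x, hx, y, hy, z, hz, rfl⟩)
  · change T.pair D _ = 0
    rw [map_add, T.pair_orth D hx hy, T.pair_orth D hy hx, T.metric_symm (D y), hD.2.1]
  · exact T.pair_constraint hD hx hy hz

theorem orth_add_orth_mem (x y : V) : T.orth x y + T.orth y x ∈ T.orthRelations := by
  let f : V →ₗ[F] V →ₗ[F] T.OrthGen ⧸ T.orthRelations :=
    (T.orth + T.orth.flip).compr₂ T.orthRelations.mkQ
  have hf : f = 0 := T.hom_ext fun s x hx => T.hom_ext fun t y hy => by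
    change T.orthRelations.mkQ (T.orth x y + T.orth y x) = 0
    rw [Submodule.mkQ_apply, Submodule.Quotient.mk_eq_zero]
    by_cases hst : s = t
    · subst hst
      exact Submodule.subset_span (Or.inl ⟨s, x, hx, y, hy, rfl⟩)
    · rw [T.orth_of_mem_ne hst hx hy, T.orth_of_mem_ne (Ne.symm hst) hy hx, add_zero]
      exact zero_mem _
  exact (Submodule.Quotient.mk_eq_zero _).1 (LinearMap.congr_fun₂ hf x y)

/-- Every functional which vanishes on the relations is the pairing with an element of the triality
algebra. -/
theorem exists_pair_eq (f : T.OrthGen →ₗ[F] F) (hf : ∀ ξ ∈ T.orthRelations, f ξ = 0) :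
    ∃ D ∈ T.algebra, T.pair D = f := by
  let D : Module.End F V :=
    (LinearMap.BilinForm.toDual T.metric T.metric_nondegenerate).symm.toLinearMap ∘ₗ
      T.orth.compr₂ f
  have hD : ∀ x y, T.metric (D x) y = f (T.orth x y) := fun x y => by
    rw [← LinearMap.BilinForm.toDual_def T.metric_nondegenerate]
    simp [D]
  have hspace : ∀ s, ∀ x ∈ T.space s, D x ∈ T.space s := fun s x hx =>
    T.mem_space_of_metric fun t hst y hy => by rw [hD, T.orth_of_mem_ne hst hx hy, map_zero]
  refine ⟨D, T.mem_algebra.2 ⟨hspace, fun x y => ?_, T.form_leibniz_of_space hspace ?_⟩,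
    T.orthGen_hom_ext fun s x hx y hy => by rw [T.pair_orth D hx hy, hD]⟩
  · rw [T.metric_symm x, hD, hD, ← map_add]
    exact hf _ (T.orth_add_orth_mem x y)
  · intro x hx y hy z hz
    have h := hf _ (Submodule.subset_span (Or.inr ⟨x, hx, y, hy, z, hz, rfl⟩))
    rw [map_add, map_add, ← hD, ← hD, ← hD, T.metric_mul', T.metric_mul', T.metric_mul'] at h
    rw [← h, T.form_swap_left x, T.form_swap_right _ z x, T.form_swap_right x y,
      T.form_swap_left x]

/-- An element outside a subspace is detected by a functional vanishing on the subspace, and all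
such functionals come from 𝔗. Membership in the relations thus becomes an identity of scalars. -/
theorem mem_orthRelations_iff {ξ : T.OrthGen} :
    ξ ∈ T.orthRelations ↔ ∀ D ∈ T.algebra, T.pair D ξ = 0 := by
  refine ⟨fun h D hD => T.pair_eq_zero_of_mem hD h, fun h => ?_⟩
  by_contra hξ
  obtain ⟨f, hne, hle⟩ := Submodule.exists_le_ker_of_notMem hξ
  obtain ⟨D, hD, rfl⟩ := T.exists_pair_eq f fun η hη => hle hη
  exact hne (h D hD)

theorem eq_zero_of_pair {D : Module.End F V} (hD : D ∈ T.algebra) (h : T.pair D = 0) : D = 0 := by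
  refine T.hom_ext fun s x hx => T.eq_of_metric fun z => ?_
  rw [LinearMap.zero_apply, map_zero]
  refine LinearMap.congr_fun (T.hom_ext (f := T.metric (D x)) fun t y hy => ?_) z
  by_cases hst : s = t
  · subst hst
    rw [← T.pair_orth D hx hy, h]
    rfl
  · rw [T.space_orthogonal s t hst _ (hD.1 s x hx) y hy]
    rfl

/-- The pairing embeds 𝔗 in the dual of O, with image the annihilator of the relations. -/
theorem finrank_orthRelations_add :
    Module.finrank F T.orthRelations + Module.finrank F T.algebra = Module.finrank F T.OrthGen := by
  have hinj : Function.Injective (T.pair ∘ₗ T.algebra.toSubmodule.subtype) := by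
    rw [← LinearMap.ker_eq_bot, LinearMap.ker_eq_bot']
    intro D hD
    exact Subtype.ext (T.eq_zero_of_pair D.2 hD)
  have hrange : LinearMap.range (T.pair ∘ₗ T.algebra.toSubmodule.subtype) =
      T.orthRelations.dualAnnihilator := by
    ext f
    rw [LinearMap.mem_range, Submodule.mem_dualAnnihilator]
    constructor
    · rintro ⟨D, rfl⟩ ξ hξ
      exact T.pair_eq_zero_of_mem D.2 hξ
    · intro hf
      obtain ⟨D, hD, rfl⟩ := T.exists_pair_eq f hf
      exact ⟨⟨D, hD⟩, rfl⟩
  have h := Subspace.finrank_add_finrank_dualAnnihilator_eq T.orthRelations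
  rw [← hrange, LinearMap.finrank_range_of_inj hinj] at h
  exact h

/-- By symmetry ⟨act ξ, η⟩ = ⟨act η, ξ⟩, which vanishes since `act η` lies in 𝔗; and 𝔗 pairs
faithfully with O. -/
theorem act_eq_zero_of_mem (hF : (2 : F) ≠ 0) {ξ : T.OrthGen} (hξ : ξ ∈ T.orthRelations) :
    T.act ξ = 0 := by
  refine T.eq_zero_of_pair (T.act_mem_algebra hF ξ) (LinearMap.ext fun η => ?_)
  rw [T.pair_act_comm, T.pair_eq_zero_of_mem (T.act_mem_algebra hF η) hξ, LinearMap.zero_apply]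

theorem actOrth_mem {P : Module.End F V} (hP : P ∈ T.algebra) {ξ : T.OrthGen}
    (hξ : ξ ∈ T.orthRelations) : T.actOrth P ξ ∈ T.orthRelations :=
  T.mem_orthRelations_iff.2 fun D hD => by
    rw [T.pair_actOrth hP]
    exact T.pair_eq_zero_of_mem (T.algebra.lie_mem hD hP) hξ

/-- The bracket of orthogonal generators is skew-symmetric modulo the relations. -/
theorem actOrth_act_add_mem (hF : (2 : F) ≠ 0) (ξ η : T.OrthGen) :
    T.actOrth (T.act ξ) η + T.actOrth (T.act η) ξ ∈ T.orthRelations :=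
  T.mem_orthRelations_iff.2 fun D hD => by
    -- Invariance and symmetry turn ⟨[D, act ξ], η⟩ into ⟨[act η, D], ξ⟩, the negative of the second
    -- summand.
    rw [map_add, T.pair_actOrth (T.act_mem_algebra hF ξ), T.pair_actOrth (T.act_mem_algebra hF η),
      ← T.act_actOrth hD, T.pair_act_comm, T.pair_actOrth hD, ← lie_skew, map_neg,
      LinearMap.neg_apply, neg_add_cancel]

end Pairing

end Triality

/-! ### Pairs of elements of the triality algebras as derivations -/

theorem Module.End.lie_apply_apply {F V : Type*} [Field F] [AddCommGroup V] [Module F V]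
    (D P : Module.End F V) (x : V) : ⁅D, P⁆ x = D (P x) - P (D x) :=
  rfl

namespace Triality

variable {F V W : Type*} [Field F] [AddCommGroup V] [Module F V] [FiniteDimensional F V]
  [AddCommGroup W] [Module F W] [FiniteDimensional F W]

section Action

variable (T : Triality F V) (T' : Triality F W)

theorem tens_of_mem_ne {s t : Fin 3} (hst : t ≠ s + 1) {x : V} {u : W} (hx : x ∈ T.space s)
    (hu : u ∈ T'.space t) : T.tens T' x u = 0 := by
  rw [tens, LinearMap.sum_apply, LinearMap.sum_apply]
  refine Finset.sum_eq_zero fun r _ => ?_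
  by_cases h : s = r
  · subst h
    simp [T'.proj_of_mem_ne hst hu]
  · simp [T.proj_of_mem_ne h hx]

theorem actOrth_orth_of_preserves {P : Module.End F V} (hP : ∀ s, ∀ x ∈ T.space s, P x ∈ T.space s)
    (x y : V) : T.actOrth P (T.orth x y) = T.orth (P x) y + T.orth x (P y) := by
  refine LinearMap.congr_fun₂ (f := T.orth.compr₂ (T.actOrth P))
    (g := T.orth ∘ₗ P + T.orth.compl₂ P) (T.hom_ext fun s x hx => T.hom_ext fun t y hy => ?_) x y
  change T.actOrth P (T.orth x y) = T.orth (P x) y + T.orth x (P y)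
  by_cases hst : s = t
  · subst hst
    exact T.actOrth_orth P hx hy
  · rw [T.orth_of_mem_ne hst hx hy, T.orth_of_mem_ne hst (hP s x hx) hy,
      T.orth_of_mem_ne hst hx (hP t y hy), map_zero, add_zero]

theorem actTens_tens_of_preserves {P : Module.End F V} {Q : Module.End F W}
    (hP : ∀ s, ∀ x ∈ T.space s, P x ∈ T.space s) (hQ : ∀ s, ∀ u ∈ T'.space s, Q u ∈ T'.space s)
    (x : V) (u : W) :
    T.actTens T' P Q (T.tens T' x u) = T.tens T' (P x) u + T.tens T' x (Q u) := by
  refine LinearMap.congr_fun₂ (f := (T.tens T').compr₂ (T.actTens T' P Q))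
    (g := T.tens T' ∘ₗ P + (T.tens T').compl₂ Q)
    (T.hom_ext fun s x hx => T'.hom_ext fun t u hu => ?_) x u
  change T.actTens T' P Q (T.tens T' x u) = T.tens T' (P x) u + T.tens T' x (Q u)
  by_cases hst : t = s + 1
  · subst hst
    exact T.actTens_tens T' P Q hx hu
  · rw [T.tens_of_mem_ne T' hst hx hu, T.tens_of_mem_ne T' hst (hP s x hx) hu,
      T.tens_of_mem_ne T' hst hx (hQ t u hu), map_zero, add_zero]

theorem tensGen_induction {p : T.TensorGen T' → Prop}
    (gen : ∀ s, ∀ x ∈ T.space s, ∀ u ∈ T'.space (s + 1), p (T.tens T' x u))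
    (add : ∀ a b, p a → p b → p (a + b)) (a : T.TensorGen T') : p a := by
  have h0 : p 0 := by
    simpa using gen 0 0 (zero_mem _) 0 (zero_mem _)
  have hs : ∀ s (t : T.space s ⊗[F] T'.space (s + 1)),
      p (LinearMap.single F (fun s => T.space s ⊗[F] T'.space (s + 1)) s t) := by
    intro s t
    induction t with
    | zero => rwa [map_zero]
    | tmul x u =>
      have := gen s x x.2 u u.2
      rwa [T.tens_of_mem T' x.2 u.2] at this
    | add a b ha hb => rw [map_add]; exact add _ _ ha hb
  have ha : a = ∑ s, LinearMap.single F (fun s => T.space s ⊗[F] T'.space (s + 1)) s (a s) :=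
    (Finset.univ_sum_single a).symm
  rw [ha]
  exact Finset.sum_induction _ p add h0 fun s _ => hs s (a s)

@[elab_as_elim]
theorem tensGen_induction₂ {T : Triality F V} {T' : Triality F W}
    {p : T.TensorGen T' → T.TensorGen T' → Prop}
    (gen : ∀ s, ∀ x ∈ T.space s, ∀ u ∈ T'.space (s + 1), ∀ t, ∀ y ∈ T.space t,
      ∀ v ∈ T'.space (t + 1), p (T.tens T' x u) (T.tens T' y v))
    (add_left : ∀ a a' b, p a b → p a' b → p (a + a') b)
    (add_right : ∀ a b b', p a b → p a b' → p a (b + b')) (a b : T.TensorGen T') : p a b := by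
  revert b
  refine T.tensGen_induction T' (p := fun a => ∀ b, p a b) (fun s x hx u hu b => ?_)
    (fun a a' h h' b => add_left a a' b (h b) (h' b)) a
  exact T.tensGen_induction T' (p := p _) (fun t y hy v hv => gen s x hx u hu t y hy v hv)
    (fun b b' => add_right _ b b') b

theorem tensOrth_add_left (a a' b : T.TensorGen T') :
    T.tensOrth T' (a + a') b = T.tensOrth T' a b + T.tensOrth T' a' b := by
  simp [tensOrth]

theorem tensOrth_add_right (a b b' : T.TensorGen T') :
    T.tensOrth T' a (b + b') = T.tensOrth T' a b + T.tensOrth T' a b' := by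
  simp [tensOrth]

theorem tensOrth'_add_left (a a' b : T.TensorGen T') :
    T.tensOrth' T' (a + a') b = T.tensOrth' T' a b + T.tensOrth' T' a' b := by
  simp [tensOrth']

theorem tensOrth'_add_right (a b b' : T.TensorGen T') :
    T.tensOrth' T' a (b + b') = T.tensOrth' T' a b + T.tensOrth' T' a b' := by
  simp [tensOrth']

theorem tensTens_add_left (a a' b : T.TensorGen T') :
    T.tensTens T' (a + a') b = T.tensTens T' a b + T.tensTens T' a' b := by
  rw [tensTens, tensTens, tensTens, ← map_add, ← Finset.sum_add_distrib]
  congr 1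
  refine Finset.sum_congr rfl fun s _ => ?_
  simp only [map_add, LinearMap.add_apply]
  abel

theorem tensTens_add_right (a b b' : T.TensorGen T') :
    T.tensTens T' a (b + b') = T.tensTens T' a b + T.tensTens T' a b' := by
  rw [T.tensTens_swap T' a (b + b'), tensTens_add_left, neg_add, ← T.tensTens_swap T' a b,
    ← T.tensTens_swap T' a b']

/-- Between two fixed sectors, the product of tensor generators is a multiple of `xy ⊗ uv`. -/
theorem exists_tensTens_tens (s t : Fin 3) : ∃ ε : F, ∀ x ∈ T.space s, ∀ u ∈ T'.space (s + 1),
    ∀ y ∈ T.space t, ∀ v ∈ T'.space (t + 1),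
    T.tensTens T' (T.tens T' x u) (T.tens T' y v) = ε • T.tens T' (T.mul x y) (T'.mul u v) := by
  have h : ∀ s t : Fin 3, s ≠ t → t ≠ s + 1 → s = t + 1 := by decide
  by_cases h1 : s = t
  · subst h1
    exact ⟨0, fun x hx u hu y hy v hv => by rw [T.tensTens_tens_self T' hx hu hy hv, zero_smul]⟩
  by_cases h2 : t = s + 1
  · exact ⟨1, fun x hx u hu y hy v hv => by
      rw [T.tensTens_tens_succ T' h2 hx hu hy hv, one_smul]⟩
  · exact ⟨-1, fun x hx u hu y hy v hv => by
      rw [T.tensTens_swap, T.tensTens_tens_succ T' (h s t h1 h2) hy hv hx hu, T.mul_comm y,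
        T'.mul_comm v]
      module⟩

variable {T T'} {D : Module.End F V} {D' : Module.End F W}

/-- `D'` may appear on the right only: its two contributions cancel because it is skew for g'. -/
theorem actOrth_tensOrth (hD : D ∈ T.algebra) (hD' : D' ∈ T'.algebra) (a b : T.TensorGen T') :
    T.actOrth D (T.tensOrth T' a b) =
      T.tensOrth T' (T.actTens T' D D' a) b + T.tensOrth T' a (T.actTens T' D D' b) := by
  induction a, b using tensGen_induction₂ with
  | gen s x hx u hu t y hy v hv =>
    have h := hD'.2.1 u v
    rw [T.actTens_tens T' D D' hx hu, T.actTens_tens T' D D' hy hv, tensOrth_add_left,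
      tensOrth_add_right, T.tensOrth_tens T' hx hu hy hv,
      T.tensOrth_tens T' (hD.1 s x hx) hu hy hv, T.tensOrth_tens T' hx hu (hD.1 t y hy) hv,
      T.tensOrth_tens T' hx (hD'.1 _ u hu) hy hv, T.tensOrth_tens T' hx hu hy (hD'.1 _ v hv),
      map_smul, T.actOrth_orth_of_preserves hD.1, T'.metric_apply hD']
    module
  | add_right _ _ _ ha hb =>
    rw [tensOrth_add_right, map_add, map_add, ha, hb, tensOrth_add_right, tensOrth_add_right]
    abel
  | add_left _ _ _ ha ha' =>
    rw [tensOrth_add_left, map_add, map_add, ha, ha', tensOrth_add_left, tensOrth_add_left]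
    abel

theorem actOrth_tensOrth' (hD : D ∈ T.algebra) (hD' : D' ∈ T'.algebra) (a b : T.TensorGen T') :
    T'.actOrth D' (T.tensOrth' T' a b) =
      T.tensOrth' T' (T.actTens T' D D' a) b + T.tensOrth' T' a (T.actTens T' D D' b) := by
  induction a, b using tensGen_induction₂ with
  | gen s x hx u hu t y hy v hv =>
    rw [T.actTens_tens T' D D' hx hu, T.actTens_tens T' D D' hy hv, tensOrth'_add_left,
      tensOrth'_add_right, T.tensOrth'_tens T' hx hu hy hv,
      T.tensOrth'_tens T' (hD.1 s x hx) hu hy hv, T.tensOrth'_tens T' hx hu (hD.1 t y hy) hv,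
      T.tensOrth'_tens T' hx (hD'.1 _ u hu) hy hv, T.tensOrth'_tens T' hx hu hy (hD'.1 _ v hv),
      map_smul, T'.actOrth_orth_of_preserves hD'.1, T.metric_apply hD]
    module
  | add_right _ _ _ ha hb =>
    rw [tensOrth'_add_right, map_add, map_add, ha, hb, tensOrth'_add_right, tensOrth'_add_right]
    abel
  | add_left _ _ _ ha ha' =>
    rw [tensOrth'_add_left, map_add, map_add, ha, ha', tensOrth'_add_left, tensOrth'_add_left]
    abel

theorem actTens_tensTens (hD : D ∈ T.algebra) (hD' : D' ∈ T'.algebra) (a b : T.TensorGen T') :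
    T.actTens T' D D' (T.tensTens T' a b) =
      T.tensTens T' (T.actTens T' D D' a) b + T.tensTens T' a (T.actTens T' D D' b) := by
  induction a, b using tensGen_induction₂ with
  | gen s x hx u hu t y hy v hv =>
    obtain ⟨ε, h⟩ := T.exists_tensTens_tens T' s t
    rw [T.actTens_tens T' D D' hx hu, T.actTens_tens T' D D' hy hv, tensTens_add_left,
      tensTens_add_right, h x hx u hu y hy v hv, h _ (hD.1 s x hx) u hu y hy v hv,
      h x hx u hu _ (hD.1 t y hy) v hv, h x hx _ (hD'.1 _ u hu) y hy v hv,
      h x hx u hu y hy _ (hD'.1 _ v hv), map_smul, T.actTens_tens_of_preserves T' hD.1 hD'.1,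
      T.apply_mul hD, T'.apply_mul hD']
    simp only [map_add, LinearMap.add_apply]
    module
  | add_right _ _ _ ha hb =>
    rw [tensTens_add_right, map_add, map_add, ha, hb, tensTens_add_right, tensTens_add_right]
    abel
  | add_left _ _ _ ha ha' =>
    rw [tensTens_add_left, map_add, map_add, ha, ha', tensTens_add_left, tensTens_add_left]
    abel

theorem actOrth_lie {P : Module.End F V} (hD : D ∈ T.algebra) (hP : P ∈ T.algebra)
    (ξ : T.OrthGen) :
    T.actOrth ⁅D, P⁆ ξ = T.actOrth D (T.actOrth P ξ) - T.actOrth P (T.actOrth D ξ) := by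
  refine LinearMap.congr_fun (f := T.actOrth ⁅D, P⁆)
    (g := T.actOrth D ∘ₗ T.actOrth P - T.actOrth P ∘ₗ T.actOrth D)
    (T.orthGen_hom_ext fun s x hx y hy => ?_) ξ
  simp only [LinearMap.sub_apply, LinearMap.comp_apply, T.actOrth_orth_of_preserves hD.1,
    T.actOrth_orth_of_preserves hP.1, T.actOrth_orth_of_preserves (T.algebra.lie_mem hD hP).1,
    map_add, Module.End.lie_apply_apply, map_sub]
  abel

theorem actTens_lie {P : Module.End F V} {P' : Module.End F W} (hD : D ∈ T.algebra)
    (hD' : D' ∈ T'.algebra) (hP : P ∈ T.algebra) (hP' : P' ∈ T'.algebra) (a : T.TensorGen T') :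
    T.actTens T' ⁅D, P⁆ ⁅D', P'⁆ a =
      T.actTens T' D D' (T.actTens T' P P' a) - T.actTens T' P P' (T.actTens T' D D' a) := by
  refine LinearMap.congr_fun (f := T.actTens T' ⁅D, P⁆ ⁅D', P'⁆)
    (g := T.actTens T' D D' ∘ₗ T.actTens T' P P' - T.actTens T' P P' ∘ₗ T.actTens T' D D')
    (T.tensGen_hom_ext T' fun s x hx y hy => ?_) a
  simp only [LinearMap.sub_apply, LinearMap.comp_apply,
    T.actTens_tens_of_preserves T' hD.1 hD'.1, T.actTens_tens_of_preserves T' hP.1 hP'.1,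
    T.actTens_tens_of_preserves T' (T.algebra.lie_mem hD hP).1 (T'.algebra.lie_mem hD' hP').1,
    map_add, Module.End.lie_apply_apply, map_sub]
  abel

variable (T T') in
/-- The action of a pair of endomorphisms on the space of all generators. -/
noncomputable def actGen (P : Module.End F V) (Q : Module.End F W) (a : T.Gen T') : T.Gen T' :=
  (T.actOrth P a.1, T'.actOrth Q a.2.1, T.actTens T' P Q a.2.2)

theorem bracket_apply (κ : F) (a b : T.Gen T') : T.bracket T' κ a b =
    (κ • T.actOrth (T.act a.1) b.1 + T.tensOrth T' a.2.2 b.2.2,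
      κ • T'.actOrth (T'.act a.2.1) b.2.1 + T.tensOrth' T' a.2.2 b.2.2,
      κ • T.actTens T' (T.act a.1) (T'.act a.2.1) b.2.2
        - κ • T.actTens T' (T.act b.1) (T'.act b.2.1) a.2.2
        + T.tensTens T' a.2.2 b.2.2) :=
  rfl

/-- Pairs of elements of the triality algebras act by derivations of the bracket. -/
theorem actGen_bracket (hF : (2 : F) ≠ 0) (κ : F) (hD : D ∈ T.algebra) (hD' : D' ∈ T'.algebra)
    (a b : T.Gen T') : T.actGen T' D D' (T.bracket T' κ a b) =
      T.bracket T' κ (T.actGen T' D D' a) b + T.bracket T' κ a (T.actGen T' D D' b) := by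
  have m := T.act_mem_algebra hF
  have m' := T'.act_mem_algebra hF
  ext1
  · simp only [actGen, bracket_apply, Prod.fst_add, T.act_actOrth hD, map_add, map_smul,
      actOrth_tensOrth hD hD', actOrth_lie hD (m _)]
    module
  ext1
  · simp only [actGen, bracket_apply, Prod.fst_add, Prod.snd_add, T'.act_actOrth hD', map_add,
      map_smul, actOrth_tensOrth' hD hD', actOrth_lie hD' (m' _)]
    module
  · simp only [actGen, bracket_apply, Prod.snd_add, T.act_actOrth hD, T'.act_actOrth hD', map_add,
      map_sub, map_smul, actTens_tensTens hD hD', actTens_lie hD hD' (m _) (m' _)]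
    module

end Action

/-! ### Consistency and skew-symmetry modulo the relations -/

section Relations

variable (T : Triality F V) (T' : Triality F W)

theorem mem_relations {a : T.Gen T'} : a ∈ T.relations T' ↔
    a.1 ∈ T.orthRelations ∧ a.2.1 ∈ T'.orthRelations ∧ a.2.2 = 0 := by
  simp [relations, Submodule.mem_prod]

/-- A relation on the left enters only through its action, so the bracket is actually zero. On the
right it is itself acted upon, and only invariance of the relations under 𝔗 is available. -/
theorem bracket_mem_left (hF : (2 : F) ≠ 0) (κ : F) {r : T.Gen T'} (hr : r ∈ T.relations T')
    (a : T.Gen T') : T.bracket T' κ r a ∈ T.relations T' := by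
  obtain ⟨h1, h2, h3⟩ := (T.mem_relations T').1 hr
  have h : T.bracket T' κ r a = 0 := by
    rw [bracket_apply, T.act_eq_zero_of_mem hF h1, T'.act_eq_zero_of_mem hF h2, h3]
    simp [actOrth, actTens, tensOrth, tensOrth', tensTens]
  rw [h]
  exact zero_mem _

theorem bracket_mem_right (hF : (2 : F) ≠ 0) (κ : F) {r : T.Gen T'} (hr : r ∈ T.relations T')
    (a : T.Gen T') : T.bracket T' κ a r ∈ T.relations T' := by
  obtain ⟨h1, h2, h3⟩ := (T.mem_relations T').1 hr
  rw [bracket_apply, T.act_eq_zero_of_mem hF h1, T'.act_eq_zero_of_mem hF h2, h3, mem_relations]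
  refine ⟨?_, ?_, ?_⟩
  · simpa [tensOrth] using
      Submodule.smul_mem _ κ (T.actOrth_mem (T.act_mem_algebra hF a.1) h1)
  · simpa [tensOrth'] using
      Submodule.smul_mem _ κ (T'.actOrth_mem (T'.act_mem_algebra hF a.2.1) h2)
  · simp [actTens, tensTens]

theorem tensOrth_add_mem (a b : T.TensorGen T') :
    T.tensOrth T' a b + T.tensOrth T' b a ∈ T.orthRelations := by
  induction a, b using tensGen_induction₂ with
  | gen s x hx u hu t y hy v hv =>
    rw [T.tensOrth_tens T' hx hu hy hv, T.tensOrth_tens T' hy hv hx hu, T'.metric_symm v,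
      ← smul_add]
    exact Submodule.smul_mem _ _ (T.orth_add_orth_mem x y)
  | add_right _ _ _ h h' =>
    rw [tensOrth_add_right, tensOrth_add_left, add_add_add_comm]
    exact add_mem h h'
  | add_left _ _ _ h h' =>
    rw [tensOrth_add_right, tensOrth_add_left, add_add_add_comm]
    exact add_mem h h'

theorem tensOrth'_add_mem (a b : T.TensorGen T') :
    T.tensOrth' T' a b + T.tensOrth' T' b a ∈ T'.orthRelations := by
  induction a, b using tensGen_induction₂ with
  | gen s x hx u hu t y hy v hv =>
    rw [T.tensOrth'_tens T' hx hu hy hv, T.tensOrth'_tens T' hy hv hx hu, T.metric_symm y,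
      ← smul_add]
    exact Submodule.smul_mem _ _ (T'.orth_add_orth_mem u v)
  | add_right _ _ _ h h' =>
    rw [tensOrth'_add_right, tensOrth'_add_left, add_add_add_comm]
    exact add_mem h h'
  | add_left _ _ _ h h' =>
    rw [tensOrth'_add_right, tensOrth'_add_left, add_add_add_comm]
    exact add_mem h h'

theorem bracket_add_mem (hF : (2 : F) ≠ 0) (κ : F) (a b : T.Gen T') :
    T.bracket T' κ a b + T.bracket T' κ b a ∈ T.relations T' := by
  rw [mem_relations, bracket_apply, bracket_apply]
  refine ⟨?_, ?_, ?_⟩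
  · have := add_mem (Submodule.smul_mem _ κ (T.actOrth_act_add_mem hF a.1 b.1))
      (T.tensOrth_add_mem T' a.2.2 b.2.2)
    rwa [smul_add, add_add_add_comm] at this
  · have := add_mem (Submodule.smul_mem _ κ (T'.actOrth_act_add_mem hF a.2.1 b.2.1))
      (T.tensOrth'_add_mem T' a.2.2 b.2.2)
    rwa [smul_add, add_add_add_comm] at this
  · simp only [Prod.snd_add]
    rw [T.tensTens_swap T' b.2.2]
    abel

theorem bracket_self_mem (hF : (2 : F) ≠ 0) (κ : F) (a : T.Gen T') :
    T.bracket T' κ a a ∈ T.relations T' := by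
  have h := Submodule.smul_mem _ (2⁻¹ : F) (T.bracket_add_mem T' hF κ a a)
  rwa [← two_smul F, inv_smul_smul₀ hF] at h

end Relations

end Triality

/-! ### The Jacobiator of a bilinear operation -/

namespace LinearMap

variable {K M : Type*} [Field K] [AddCommGroup M] [Module K M] (β : M →ₗ[K] M →ₗ[K] M)

/-- The Jacobiator of a bilinear operation. -/
def jacobiator (a b c : M) : M := β (β a b) c + β (β b c) a + β (β c a) b

theorem jacobiator_rotate (a b c : M) : β.jacobiator a b c = β.jacobiator b c a := by
  rw [jacobiator, jacobiator]
  abel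

theorem jacobiator_add_left (a a' b c : M) :
    β.jacobiator (a + a') b c = β.jacobiator a b c + β.jacobiator a' b c := by
  simp only [jacobiator, map_add, LinearMap.add_apply]
  abel

theorem jacobiator_add_mid (a b b' c : M) :
    β.jacobiator a (b + b') c = β.jacobiator a b c + β.jacobiator a b' c := by
  simp only [β.jacobiator_rotate a, jacobiator_add_left]

theorem jacobiator_add_right (a b c c' : M) :
    β.jacobiator a b (c + c') = β.jacobiator a b c + β.jacobiator a b c' := by
  simp only [← β.jacobiator_rotate _ a b, jacobiator_add_left]

variable {β}

theorem jacobiator_swap (h : ∀ a b, β a b = -β b a) (a b c : M) :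
    β.jacobiator a b c = -β.jacobiator b a c := by
  rw [jacobiator, jacobiator, h b a, h a c, h c b]
  simp only [map_neg, LinearMap.neg_apply]
  abel

/-- For a skew operation the Jacobiator measures the failure of `β a` to be a derivation. -/
theorem jacobiator_eq_leibniz (h : ∀ a b, β a b = -β b a) (a b c : M) :
    β.jacobiator a b c = β (β a b) c + β b (β a c) - β a (β b c) := by
  rw [jacobiator, h c a, h (β b c) a, map_neg, LinearMap.neg_apply, h b (β a c)]
  abel

end LinearMap

/-! ### The Jacobi identity on the quotient -/

namespace Triality

variable {F V W : Type*} [Field F] [AddCommGroup V] [Module F V] [FiniteDimensional F V]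
  [AddCommGroup W] [Module F W] [FiniteDimensional F W]

section Jacobi

variable (T : Triality F V) (T' : Triality F W)

/-- The bracket induced on the quotient by the relations. -/
noncomputable def quotBracket (hF : (2 : F) ≠ 0) (κ : F) :
    (T.Gen T' ⧸ T.relations T') →ₗ[F] (T.Gen T' ⧸ T.relations T') →ₗ[F]
      T.Gen T' ⧸ T.relations T' :=
  ((T.relations T').liftQ ((T.relations T').liftQ
    ((T.bracket T' κ).compr₂ (T.relations T').mkQ) (fun r hr => by
      rw [LinearMap.mem_ker]
      refine LinearMap.ext fun a => ?_
      exact (Submodule.Quotient.mk_eq_zero _).2 (T.bracket_mem_left T' hF κ hr a))).flip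
    (fun r hr => by
      rw [LinearMap.mem_ker]
      refine LinearMap.ext fun a => ?_
      obtain ⟨a, rfl⟩ := Submodule.mkQ_surjective _ a
      exact (Submodule.Quotient.mk_eq_zero _).2 (T.bracket_mem_right T' hF κ hr a))).flip

variable {T T'}

theorem quotBracket_mkQ (hF : (2 : F) ≠ 0) (κ : F) (a b : T.Gen T') :
    T.quotBracket T' hF κ ((T.relations T').mkQ a) ((T.relations T').mkQ b) =
      (T.relations T').mkQ (T.bracket T' κ a b) :=
  rfl

theorem quotBracket_self (hF : (2 : F) ≠ 0) (κ : F) (a : T.Gen T' ⧸ T.relations T') :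
    T.quotBracket T' hF κ a a = 0 := by
  obtain ⟨a, rfl⟩ := Submodule.mkQ_surjective _ a
  rw [quotBracket_mkQ]
  exact (Submodule.Quotient.mk_eq_zero _).2 (T.bracket_self_mem T' hF κ a)

theorem quotBracket_swap (hF : (2 : F) ≠ 0) (κ : F) (a b : T.Gen T' ⧸ T.relations T') :
    T.quotBracket T' hF κ a b = -T.quotBracket T' hF κ b a := by
  have h := quotBracket_self hF κ (a + b)
  simp only [map_add, LinearMap.add_apply, quotBracket_self, zero_add, add_zero] at h
  exact eq_neg_of_add_eq_zero_right h

variable (hF : (2 : F) ≠ 0) (κ : F)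

/-- This holds before passing to the quotient and for every κ, so the Leibniz rule for orthogonal
generators does too. -/
theorem bracket_orth (ξ : T.OrthGen) (η : T'.OrthGen) (a : T.Gen T') :
    T.bracket T' κ (ξ, η, 0) a = κ • T.actGen T' (T.act ξ) (T'.act η) a := by
  rw [bracket_apply, actGen]
  simp [tensOrth, tensOrth', tensTens, actTens]

theorem bracket_orth_leibniz (hF : (2 : F) ≠ 0) (κ : F) (ξ : T.OrthGen) (η : T'.OrthGen) (b c : T.Gen T') :
    T.bracket T' κ (ξ, η, 0) (T.bracket T' κ b c) =
      T.bracket T' κ (T.bracket T' κ (ξ, η, 0) b) c +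
        T.bracket T' κ b (T.bracket T' κ (ξ, η, 0) c) := by
  rw [bracket_orth, bracket_orth, bracket_orth, actGen_bracket hF κ (T.act_mem_algebra hF ξ)
    (T'.act_mem_algebra hF η), smul_add, map_smul, map_smul, LinearMap.smul_apply]

theorem jacobiator_orth (ξ : T.OrthGen) (η : T'.OrthGen) (b c : T.Gen T' ⧸ T.relations T') :
    (T.quotBracket T' hF κ).jacobiator ((T.relations T').mkQ (ξ, η, 0)) b c = 0 := by
  obtain ⟨b, rfl⟩ := Submodule.mkQ_surjective _ b
  obtain ⟨c, rfl⟩ := Submodule.mkQ_surjective _ c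
  rw [LinearMap.jacobiator_eq_leibniz (quotBracket_swap hF _)]
  simp only [quotBracket_mkQ]
  rw [bracket_orth_leibniz hF, map_add, sub_self]

theorem bracket_tens (κ : F) (ξ : T.OrthGen) (η : T'.OrthGen) (X Y : T.TensorGen T') :
    T.bracket T' κ (ξ, η, X) (0, 0, Y) = (T.tensOrth T' X Y, T.tensOrth' T' X Y,
      κ • T.actTens T' (T.act ξ) (T'.act η) Y + T.tensTens T' X Y) := by
  rw [bracket_apply]
  simp [actTens]

/-- The third condition is an equation, not a congruence, since the relations have no tensor
component. -/
theorem jacobiator_tens_eq_zero {X Y Z : T.TensorGen T'}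
    (h1 : T.tensOrth T' (T.tensTens T' X Y) Z + T.tensOrth T' (T.tensTens T' Y Z) X +
      T.tensOrth T' (T.tensTens T' Z X) Y ∈ T.orthRelations)
    (h2 : T.tensOrth' T' (T.tensTens T' X Y) Z + T.tensOrth' T' (T.tensTens T' Y Z) X +
      T.tensOrth' T' (T.tensTens T' Z X) Y ∈ T'.orthRelations)
    (h3 : κ • T.actTens T' (T.act (T.tensOrth T' X Y)) (T'.act (T.tensOrth' T' X Y)) Z
        + T.tensTens T' (T.tensTens T' X Y) Z +
      (κ • T.actTens T' (T.act (T.tensOrth T' Y Z)) (T'.act (T.tensOrth' T' Y Z)) X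
        + T.tensTens T' (T.tensTens T' Y Z) X) +
      (κ • T.actTens T' (T.act (T.tensOrth T' Z X)) (T'.act (T.tensOrth' T' Z X)) Y
        + T.tensTens T' (T.tensTens T' Z X) Y) = 0) :
    (T.quotBracket T' hF κ).jacobiator ((T.relations T').mkQ (0, 0, X)) ((T.relations T').mkQ (0, 0, Y))
      ((T.relations T').mkQ (0, 0, Z)) = 0 := by
  rw [LinearMap.jacobiator]
  simp only [quotBracket_mkQ, ← map_add]
  rw [Submodule.mkQ_apply, Submodule.Quotient.mk_eq_zero, mem_relations]
  simp only [bracket_tens, Prod.mk_add_mk, map_zero]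
  have h0 : ∀ X, T.actTens T' 0 0 X = 0 := fun X => by simp [actTens]
  simp only [h0, smul_zero, zero_add]
  exact ⟨h1, h2, h3⟩

section Sectors

variable {s t r : Fin 3} {x y z : V} {u v w : W}

/-- Only diagonal boxes occur. Each term such as g'(u,v) g(y,z) x ⊗ w arises once from either
triality, with opposite signs, so κ is arbitrary but must be common to both. -/
theorem jacobiator_same (hx : x ∈ T.space s) (hu : u ∈ T'.space (s + 1)) (hy : y ∈ T.space s)
    (hv : v ∈ T'.space (s + 1)) (hz : z ∈ T.space s) (hw : w ∈ T'.space (s + 1)) :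
    (T.quotBracket T' hF κ).jacobiator ((T.relations T').mkQ (0, 0, T.tens T' x u))
      ((T.relations T').mkQ (0, 0, T.tens T' y v))
      ((T.relations T').mkQ (0, 0, T.tens T' z w)) = 0 := by
  have hO : ∀ X, T.tensOrth T' 0 X = 0 := by simp [tensOrth]
  have hO' : ∀ X, T.tensOrth' T' 0 X = 0 := by simp [tensOrth']
  have hT : ∀ X, T.tensTens T' 0 X = 0 := by simp [tensTens]
  have hb : ∀ x ∈ T.space s, ∀ y ∈ T.space s, ∀ z ∈ T.space s,
      T.box x y z = (2⁻¹ : F) • (T.metric y z • x - T.metric x z • y) := by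
    intro x hx y hy z hz
    rw [T.box_apply, T.mul_eq_zero hy hz, T.mul_eq_zero hx hz]
    simp
  have hb' : ∀ x ∈ T'.space (s + 1), ∀ y ∈ T'.space (s + 1), ∀ z ∈ T'.space (s + 1),
      T'.box x y z = (2⁻¹ : F) • (T'.metric y z • x - T'.metric x z • y) := by
    intro x hx y hy z hz
    rw [T'.box_apply, T'.mul_eq_zero hy hz, T'.mul_eq_zero hx hz]
    simp
  refine jacobiator_tens_eq_zero hF κ ?_ ?_ ?_
  · rw [T.tensTens_tens_self T' hx hu hy hv, T.tensTens_tens_self T' hy hv hz hw,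
      T.tensTens_tens_self T' hz hw hx hu, hO, hO, hO, add_zero, add_zero]
    exact zero_mem _
  · rw [T.tensTens_tens_self T' hx hu hy hv, T.tensTens_tens_self T' hy hv hz hw,
      T.tensTens_tens_self T' hz hw hx hu, hO', hO', hO', add_zero, add_zero]
    exact zero_mem _
  · rw [T.tensTens_tens_self T' hx hu hy hv, T.tensTens_tens_self T' hy hv hz hw,
      T.tensTens_tens_self T' hz hw hx hu, hT, hT, hT, T.tensOrth_tens T' hx hu hy hv,
      T.tensOrth_tens T' hy hv hz hw, T.tensOrth_tens T' hz hw hx hu,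
      T.tensOrth'_tens T' hx hu hy hv,
      T.tensOrth'_tens T' hy hv hz hw, T.tensOrth'_tens T' hz hw hx hu]
    simp only [map_smul]
    rw [T.act_orth hx hy, T.act_orth hy hz, T.act_orth hz hx, T'.act_orth hu hv,
      T'.act_orth hv hw, T'.act_orth hw hu, T.actTens_tens T' _ _ hx hu,
      T.actTens_tens T' _ _ hy hv, T.actTens_tens T' _ _ hz hw]
    simp only [LinearMap.smul_apply]
    rw [hb x hx y hy z hz, hb y hy z hz x hx, hb z hz x hx y hy, hb' u hu v hv w hw,
      hb' v hv w hw u hu, hb' w hw u hu v hv]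
    simp only [map_smul, map_sub, LinearMap.smul_apply, LinearMap.sub_apply, T.metric_symm y x,
      T.metric_symm z x, T.metric_symm z y, T'.metric_symm v u, T'.metric_symm w u,
      T'.metric_symm w v]
    module

theorem tensTens_neg_left (X Y : T.TensorGen T') :
    T.tensTens T' (-X) Y = -T.tensTens T' X Y := by
  rw [eq_neg_iff_add_eq_zero, ← tensTens_add_left, neg_add_cancel]
  simp [tensTens]

theorem orth_mul_mem (T : Triality F V) (hxy : T.mul x y ∈ T.space r) (hz : z ∈ T.space r)
    (hyz : T.mul y z ∈ T.space s) (hx : x ∈ T.space s) (hzx : T.mul z x ∈ T.space t)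
    (hy : y ∈ T.space t) :
    T.orth (T.mul x y) z + T.orth (T.mul y z) x + T.orth (T.mul z x) y ∈ T.orthRelations :=
  T.mem_orthRelations_iff.2 fun D hD => by
    have h := hD.2.2 x y z
    rw [map_add, map_add, T.pair_orth D hxy hz, T.pair_orth D hyz hx, T.pair_orth D hzx hy,
      T.metric_apply hD, T.metric_apply hD, T.metric_apply hD, T.metric_mul, T.metric_mul,
      T.metric_mul, T.form_swap_right y z, T.form_swap_left y, T.form_swap_left z,
      T.form_swap_right x z]
    linear_combination -h

/-- In one cyclic orientation of the sectors both brackets carry a plus sign, in the other both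
carry a minus sign; the result is the same. -/
theorem tensTens_tensTens_tens (hst : s ≠ t) (hx : x ∈ T.space s) (hu : u ∈ T'.space (s + 1))
    (hy : y ∈ T.space s) (hv : v ∈ T'.space (s + 1)) (hz : z ∈ T.space t)
    (hw : w ∈ T'.space (t + 1)) :
    T.tensTens T' (T.tensTens T' (T.tens T' y v) (T.tens T' z w)) (T.tens T' x u) =
      T.tens T' (T.mul x (T.mul y z)) (T'.mul u (T'.mul v w)) := by
  obtain ⟨r, hsr, htr⟩ := Fin.exists_third hst
  have hyz := T.mul_mem hsr htr hy hz
  have hvw : T'.mul v w ∈ T'.space (r + 1) :=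
    T'.mul_mem (fun h => hsr (add_right_cancel h)) (fun h => htr (add_right_cancel h)) hv hw
  have hc : ∀ s t r : Fin 3, s ≠ t → s ≠ r → t ≠ r → (t = s + 1 ∧ s = r + 1) ∨
    (s = t + 1 ∧ r = s + 1) := by decide
  rcases hc s t r hst hsr htr with ⟨h1, h2⟩ | ⟨h1, h2⟩
  · rw [T.tensTens_tens_succ T' h1 hy hv hz hw, T.tensTens_tens_succ T' h2 hyz hvw hx hu,
      T.mul_comm x, T'.mul_comm u]
  · rw [T.tensTens_swap T' (T.tens T' y v), T.tensTens_tens_succ T' h1 hz hw hy hv,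
      T.mul_comm z, T'.mul_comm w, tensTens_neg_left, ← T.tensTens_swap,
      T.tensTens_tens_succ T' h2 hx hu hyz hvw]

/-- Put A = x(yz), B = u(vw), g = g(x,y), g' = g'(u,v). By the Clifford relation the double products
give A ⊗ B - (2g z - A) ⊗ (2g' w - B) = 2g' A ⊗ w + 2g z ⊗ B - 4gg' z ⊗ w. The boxes give κ/8 times
the same expression, which is why κ = -8. -/
theorem jacobiator_pair (hst : s ≠ t) (hx : x ∈ T.space s) (hu : u ∈ T'.space (s + 1))
    (hy : y ∈ T.space s) (hv : v ∈ T'.space (s + 1)) (hz : z ∈ T.space t)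
    (hw : w ∈ T'.space (t + 1)) :
    (T.quotBracket T' hF (-8)).jacobiator ((T.relations T').mkQ (0, 0, T.tens T' x u))
      ((T.relations T').mkQ (0, 0, T.tens T' y v))
      ((T.relations T').mkQ (0, 0, T.tens T' z w)) = 0 := by
  have hst' : s + 1 ≠ t + 1 := fun h => hst (add_right_cancel h)
  obtain ⟨r, hsr, htr⟩ := Fin.exists_third hst
  have hsr' : s + 1 ≠ r + 1 := fun h => hsr (add_right_cancel h)
  have htr' : t + 1 ≠ r + 1 := fun h => htr (add_right_cancel h)
  have hO : ∀ X, T.tensOrth T' 0 X = 0 := by simp [tensOrth]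
  have hO' : ∀ X, T.tensOrth' T' 0 X = 0 := by simp [tensOrth']
  have hT : ∀ X, T.tensTens T' 0 X = 0 := by simp [tensTens]
  have h0 : ∀ X, T.actTens T' 0 0 X = 0 := fun X => by simp [actTens]
  have h8 : (8 : F) * 8⁻¹ = 1 := by
    refine mul_inv_cancel₀ ?_
    have : (8 : F) = 2 ^ 3 := by norm_num
    rw [this]
    exact pow_ne_zero _ hF
  obtain ⟨ε, hε⟩ := T.exists_tensTens_tens T' s t
  obtain ⟨δ, hδ⟩ := T.exists_tensTens_tens T' t s
  have hor : ∀ a ∈ T.space s, ∀ b ∈ T'.space (s + 1), ∀ a' ∈ T.space r, ∀ b' ∈ T'.space (r + 1),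
      T.tensOrth T' (T.tens T' a' b') (T.tens T' a b) = 0 := by
    intro a ha b hb a' ha' b' hb'
    rw [T.tensOrth_tens T' ha' hb' ha hb, T.orth_of_mem_ne hsr.symm ha' ha, smul_zero]
  have hor' : ∀ a ∈ T.space s, ∀ b ∈ T'.space (s + 1), ∀ a' ∈ T.space r, ∀ b' ∈ T'.space (r + 1),
      T.tensOrth' T' (T.tens T' a' b') (T.tens T' a b) = 0 := by
    intro a ha b hb a' ha' b' hb'
    rw [T.tensOrth'_tens T' ha' hb' ha hb, T'.orth_of_mem_ne hsr'.symm hb' hb, smul_zero]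
  have hsmul : ∀ (c : F) X Y, T.tensOrth T' (c • X) Y = c • T.tensOrth T' X Y := by simp [tensOrth]
  have hsmul' : ∀ (c : F) X Y, T.tensOrth' T' (c • X) Y = c • T.tensOrth' T' X Y := by
    simp [tensOrth']
  refine jacobiator_tens_eq_zero hF (-8) ?_ ?_ ?_
  · rw [T.tensTens_tens_self T' hx hu hy hv, hε y hy v hv z hz w hw, hδ z hz w hw x hx u hu,
      hO, hsmul, hsmul,
      hor x hx u hu _ (T.mul_mem hsr htr hy hz) _ (T'.mul_mem hsr' htr' hv hw),
      hor y hy v hv _ (T.mul_mem htr hsr hz hx) _ (T'.mul_mem htr' hsr' hw hu)]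
    simp
  · rw [T.tensTens_tens_self T' hx hu hy hv, hε y hy v hv z hz w hw, hδ z hz w hw x hx u hu,
      hO', hsmul', hsmul',
      hor' x hx u hu _ (T.mul_mem hsr htr hy hz) _ (T'.mul_mem hsr' htr' hv hw),
      hor' y hy v hv _ (T.mul_mem htr hsr hz hx) _ (T'.mul_mem htr' hsr' hw hu)]
    simp
  · rw [tensTens_tensTens_tens hst hx hu hy hv hz hw, T.tensTens_swap T' (T.tens T' z w),
      tensTens_neg_left, tensTens_tensTens_tens hst hy hv hx hu hz hw,
      T.tensTens_tens_self T' hx hu hy hv, hT, T.tensOrth_tens T' hx hu hy hv,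
      T.tensOrth_tens T' hy hv hz hw, T.tensOrth_tens T' hz hw hx hu,
      T.tensOrth'_tens T' hx hu hy hv, T.tensOrth'_tens T' hy hv hz hw,
      T.tensOrth'_tens T' hz hw hx hu, T.orth_of_mem_ne hst hy hz, T.orth_of_mem_ne hst.symm hz hx,
      T'.orth_of_mem_ne hst' hv hw, T'.orth_of_mem_ne hst'.symm hw hu]
    simp only [smul_zero, map_zero, h0, zero_add, add_zero, map_smul]
    rw [T.act_orth hx hy, T'.act_orth hu hv, T.actTens_tens T' _ _ hz hw]
    simp only [LinearMap.smul_apply]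
    rw [T.box_apply, T'.box_apply, T.space_orthogonal s t hst x hx z hz,
      T.space_orthogonal s t hst y hy z hz, T'.space_orthogonal _ _ hst' u hu w hw,
      T'.space_orthogonal _ _ hst' v hv w hw, T.mul_mul_swap hst hx hy hz,
      T'.mul_mul_swap hst' hu hv hw]
    simp only [map_smul, map_sub, LinearMap.smul_apply, LinearMap.sub_apply,
      zero_smul, sub_zero, smul_zero, zero_add]
    have e : ∀ c : F, -8 * (c * 8⁻¹) = -c := fun c => by linear_combination (-c) * h8
    have h88 : ∀ (c d : F) (X Y : T.TensorGen T'),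
        (-8 : F) • (c • (8⁻¹ : F) • X + d • (8⁻¹ : F) • Y) = -(c • X + d • Y) := fun c d X Y => by
      simp only [smul_add, smul_smul, e]
      module
    rw [h88]
    module

/-- Each product falls into the sector of the remaining argument. The two orthogonal components are
τ'(u,v,w), respectively τ(x,y,z), times an instance of the triality constraint; no tensor component
arises. -/
theorem jacobiator_distinct (hst : t = s + 1) (htr : r = t + 1) (hx : x ∈ T.space s)
    (hu : u ∈ T'.space (s + 1)) (hy : y ∈ T.space t) (hv : v ∈ T'.space (t + 1))
    (hz : z ∈ T.space r) (hw : w ∈ T'.space (r + 1)) :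
    (T.quotBracket T' hF κ).jacobiator ((T.relations T').mkQ (0, 0, T.tens T' x u))
      ((T.relations T').mkQ (0, 0, T.tens T' y v))
      ((T.relations T').mkQ (0, 0, T.tens T' z w)) = 0 := by
  have hcyc : ∀ s t r : Fin 3, t = s + 1 → r = t + 1 → s = r + 1 ∧ s ≠ t ∧ t ≠ r ∧ r ≠ s := by
    decide
  obtain ⟨hrs, h1, h2, h3⟩ := hcyc s t r hst htr
  have h1' : s + 1 ≠ t + 1 := fun h => h1 (add_right_cancel h)
  have h2' : t + 1 ≠ r + 1 := fun h => h2 (add_right_cancel h)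
  have h3' : r + 1 ≠ s + 1 := fun h => h3 (add_right_cancel h)
  have h0 : ∀ X, T.actTens T' 0 0 X = 0 := fun X => by simp [actTens]
  have mxy := T.mul_mem h3.symm h2 hx hy
  have myz := T.mul_mem h1.symm h3 hy hz
  have mzx := T.mul_mem h2.symm h1 hz hx
  have muv := T'.mul_mem h3'.symm h2' hu hv
  have mvw := T'.mul_mem h1'.symm h3' hv hw
  have mwu := T'.mul_mem h2'.symm h1' hw hu
  refine jacobiator_tens_eq_zero hF κ ?_ ?_ ?_
  · rw [T.tensTens_tens_succ T' hst hx hu hy hv, T.tensTens_tens_succ T' htr hy hv hz hw,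
      T.tensTens_tens_succ T' hrs hz hw hx hu, T.tensOrth_tens T' mxy muv hz hw,
      T.tensOrth_tens T' myz mvw hx hu, T.tensOrth_tens T' mzx mwu hy hv, T'.metric_mul,
      T'.metric_mul, T'.metric_mul, T'.form_swap_right v w u, T'.form_swap_left v u w,
      T'.form_swap_left w u v, T'.form_swap_right u w v, ← smul_add, ← smul_add]
    exact Submodule.smul_mem _ _ (T.orth_mul_mem mxy hz myz hx mzx hy)
  · rw [T.tensTens_tens_succ T' hst hx hu hy hv, T.tensTens_tens_succ T' htr hy hv hz hw,
      T.tensTens_tens_succ T' hrs hz hw hx hu, T.tensOrth'_tens T' mxy muv hz hw,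
      T.tensOrth'_tens T' myz mvw hx hu, T.tensOrth'_tens T' mzx mwu hy hv, T.metric_mul,
      T.metric_mul, T.metric_mul, T.form_swap_right y z x, T.form_swap_left y x z,
      T.form_swap_left z x y, T.form_swap_right x z y, ← smul_add, ← smul_add]
    exact Submodule.smul_mem _ _ (T'.orth_mul_mem muv hw mvw hu mwu hv)
  · rw [T.tensTens_tens_succ T' hst hx hu hy hv, T.tensTens_tens_succ T' htr hy hv hz hw,
      T.tensTens_tens_succ T' hrs hz hw hx hu, T.tensTens_tens_self T' mxy muv hz hw,
      T.tensTens_tens_self T' myz mvw hx hu, T.tensTens_tens_self T' mzx mwu hy hv,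
      T.tensOrth_tens T' hx hu hy hv,
      T.tensOrth_tens T' hy hv hz hw, T.tensOrth_tens T' hz hw hx hu,
      T.tensOrth'_tens T' hx hu hy hv, T.tensOrth'_tens T' hy hv hz hw,
      T.tensOrth'_tens T' hz hw hx hu, T.orth_of_mem_ne h1 hx hy, T.orth_of_mem_ne h2 hy hz,
      T.orth_of_mem_ne h3 hz hx, T'.orth_of_mem_ne h1' hu hv, T'.orth_of_mem_ne h2' hv hw,
      T'.orth_of_mem_ne h3' hw hu]
    simp only [smul_zero, map_zero, h0, add_zero]

end Sectors

theorem jacobiator_tens (X Y Z : T.TensorGen T') :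
    (T.quotBracket T' hF (-8)).jacobiator ((T.relations T').mkQ (0, 0, X)) ((T.relations T').mkQ (0, 0, Y))
      ((T.relations T').mkQ (0, 0, Z)) = 0 := by
  have hadd : ∀ X Y : T.TensorGen T', (T.relations T').mkQ (0, 0, X + Y) =
      (T.relations T').mkQ (0, 0, X) + (T.relations T').mkQ (0, 0, Y) := fun X Y => by
    rw [← map_add, Prod.mk_add_mk, Prod.mk_add_mk, add_zero, add_zero]
  revert Z
  induction X, Y using tensGen_induction₂ with
  | add_left a a' b h h' => intro Z; rw [hadd, LinearMap.jacobiator_add_left, h, h', add_zero]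
  | add_right a b b' h h' => intro Z; rw [hadd, LinearMap.jacobiator_add_mid, h, h', add_zero]
  | gen s x hx u hu t y hy v hv =>
    intro Z
    refine T.tensGen_induction T' (p := fun Z => (T.quotBracket T' hF (-8)).jacobiator
      ((T.relations T').mkQ (0, 0, _)) ((T.relations T').mkQ (0, 0, _))
      ((T.relations T').mkQ (0, 0, Z)) = 0) ?_ ?_ Z
    · intro r z hz w hw
      by_cases hst : s = t
      · subst hst
        by_cases hsr : s = r
        · subst hsr
          exact jacobiator_same hF (-8) hx hu hy hv hz hw
        · exact jacobiator_pair hF hsr hx hu hy hv hz hw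
      by_cases hsr : s = r
      · subst hsr
        rw [← LinearMap.jacobiator_rotate]
        exact jacobiator_pair hF hst hz hw hx hu hy hv
      by_cases htr : t = r
      · subst htr
        rw [LinearMap.jacobiator_rotate]
        exact jacobiator_pair hF (Ne.symm hst) hy hv hz hw hx hu
      have hd : ∀ s t r : Fin 3, s ≠ t → s ≠ r → t ≠ r → (t = s + 1 ∧ r = t + 1) ∨
        (s = t + 1 ∧ r = s + 1) := by decide
      rcases hd s t r hst hsr htr with ⟨h1, h2⟩ | ⟨h1, h2⟩
      · exact jacobiator_distinct hF (-8) h1 h2 hx hu hy hv hz hw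
      · rw [LinearMap.jacobiator_swap (quotBracket_swap hF _), jacobiator_distinct hF (-8) h1 h2 hy hv hx hu hz hw, neg_zero]
    · intro a b h h'
      rw [hadd, LinearMap.jacobiator_add_right, h, h', add_zero]

theorem jacobiator_eq_zero (a b c : T.Gen T' ⧸ T.relations T') :
    (T.quotBracket T' hF (-8)).jacobiator a b c = 0 := by
  have hdec : ∀ a : T.Gen T' ⧸ T.relations T', ∃ ξ η X, a = (T.relations T').mkQ (ξ, η, 0) +
      (T.relations T').mkQ (0, 0, X) := fun a => by
    obtain ⟨⟨ξ, η, X⟩, rfl⟩ := Submodule.mkQ_surjective _ a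
    refine ⟨ξ, η, X, ?_⟩
    rw [← map_add, Prod.mk_add_mk, Prod.mk_add_mk, add_zero, add_zero, zero_add]
  obtain ⟨ξ, η, X, rfl⟩ := hdec a
  rw [LinearMap.jacobiator_add_left, jacobiator_orth, zero_add, LinearMap.jacobiator_rotate]
  obtain ⟨ξ, η, Y, rfl⟩ := hdec b
  rw [LinearMap.jacobiator_add_left, jacobiator_orth, zero_add, LinearMap.jacobiator_rotate]
  obtain ⟨ξ, η, Z, rfl⟩ := hdec c
  rw [LinearMap.jacobiator_add_left, jacobiator_orth, zero_add, LinearMap.jacobiator_rotate]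
  exact jacobiator_tens hF X Y Z

variable (T T') in
/-- The quotient of the generators by the relations, with the bracket for `κ = -8`. -/
@[reducible]
noncomputable def quotLieRing : LieRing (T.Gen T' ⧸ T.relations T') where
  bracket a b := T.quotBracket T' hF (-8) a b
  add_lie a b c := by simp
  lie_add a b c := by simp
  lie_self a := quotBracket_self hF _ a
  leibniz_lie a b c := by
    have h := jacobiator_eq_zero hF a b c
    rw [LinearMap.jacobiator_eq_leibniz (quotBracket_swap hF _)] at h
    exact (sub_eq_zero.1 h).symm

variable (T T') in
@[reducible]
noncomputable def quotLieAlgebra :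
    letI := T.quotLieRing T' hF
    LieAlgebra F (T.Gen T' ⧸ T.relations T') :=
  letI := T.quotLieRing T' hF
  { lie_smul := fun c a b => map_smul (T.quotBracket T' hF (-8) a) c b }

end Jacobi

end Triality

/-! ### Traces, and the scalar (n + 4)/4 -/

/-- The trace of the flip of a tensor square. -/
theorem TensorProduct.trace_comm_self {K M : Type*} [Field K] [AddCommGroup M] [Module K M]
    [FiniteDimensional K M] :
    LinearMap.trace K (M ⊗[K] M) (TensorProduct.comm K M M).toLinearMap =
      Module.finrank K M := by
  classical
  let b := Module.finBasis K M
  rw [LinearMap.trace_eq_matrix_trace K (b.tensorProduct b), Matrix.trace, Fintype.sum_prod_type]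
  simp [LinearMap.toMatrix_apply, Finsupp.single_apply]

theorem LinearMap.trace_pi {K ι : Type*} [Field K] [Fintype ι] [DecidableEq ι] {M : ι → Type*}
    [∀ i, AddCommGroup (M i)] [∀ i, Module K (M i)] [∀ i, FiniteDimensional K (M i)]
    (f : Module.End K (∀ i, M i)) :
    LinearMap.trace K _ f =
      ∑ i, LinearMap.trace K (M i) (LinearMap.proj i ∘ₗ f ∘ₗ LinearMap.single K M i) := by
  have h : f = ∑ i, (f ∘ₗ LinearMap.single K M i) ∘ₗ LinearMap.proj i := by
    refine LinearMap.ext fun x => ?_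
    simp only [LinearMap.sum_apply, LinearMap.comp_apply, LinearMap.proj_apply]
    rw [← map_sum]
    exact congrArg f (Finset.univ_sum_single x).symm
  conv_lhs => rw [h]
  rw [map_sum]
  exact Finset.sum_congr rfl fun i _ => LinearMap.trace_comp_comm' _ _

/-- Adjoint operators have the same trace. -/
theorem LinearMap.BilinForm.trace_eq_of_adjoint {K M : Type*} [Field K] [AddCommGroup M]
    [Module K M] [FiniteDimensional K M] {B : LinearMap.BilinForm K M} (hB : B.Nondegenerate)
    {f h : Module.End K M} (H : ∀ x y, B (f x) y = B x (h y)) :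
    LinearMap.trace K M f = LinearMap.trace K M h := by
  have e : (B.toDual hB).conj f = Module.Dual.transpose (R := K) h := by
    ext φ y
    obtain ⟨x, rfl⟩ := (B.toDual hB).surjective φ
    simp [LinearEquiv.conj_apply, LinearMap.BilinForm.toDual_def, H, Module.Dual.transpose_apply]
  rw [← LinearMap.trace_conj' f (B.toDual hB), e, LinearMap.trace_transpose']

namespace Triality

variable {F V W : Type*} [Field F] [AddCommGroup V] [Module F V] [FiniteDimensional F V]
  [AddCommGroup W] [Module F W] [FiniteDimensional F W]

section Trace

variable (T : Triality F V)

theorem orthGen_induction {p : T.OrthGen → Prop}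
    (gen : ∀ s, ∀ x ∈ T.space s, ∀ y ∈ T.space s, p (T.orth x y))
    (add : ∀ a b, p a → p b → p (a + b)) (a : T.OrthGen) : p a := by
  have h0 : p 0 := by
    simpa using gen 0 0 (zero_mem _) 0 (zero_mem _)
  have hs : ∀ s (t : T.space s ⊗[F] T.space s),
      p (LinearMap.single F (fun s => T.space s ⊗[F] T.space s) s t) := by
    intro s t
    induction t with
    | zero => rwa [map_zero]
    | tmul x u =>
      have := gen s x x.2 u u.2
      rwa [T.orth_of_mem x.2 u.2] at this
    | add a b ha hb => rw [map_add]; exact add _ _ ha hb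
  have ha : a = ∑ s, LinearMap.single F (fun s => T.space s ⊗[F] T.space s) s (a s) :=
    (Finset.univ_sum_single a).symm
  rw [ha]
  exact Finset.sum_induction _ p add h0 fun s _ => hs s (a s)

/-- The endomorphism `z ↦ g(y, z) x` attached to `orth x y`. -/
noncomputable def toEnd : T.OrthGen →ₗ[F] Module.End F V :=
  TensorProduct.lift (LinearMap.mk₂ F (fun x y => (T.metric y).smulRight x)
    (by intros; ext; simp) (by intros; ext; simp [smul_smul, _root_.mul_comm])
    (by intros; ext; simp [add_smul]) (by intros; ext; simp [mul_smul])) ∘ₗ T.orthIncl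

theorem toEnd_orth {s : Fin 3} {x y : V} (hx : x ∈ T.space s) (hy : y ∈ T.space s) :
    T.toEnd (T.orth x y) = (T.metric y).smulRight x := by
  simp [toEnd, T.orthIncl_orth hx hy]

/-- Writing the product terms as traces expresses `act ξ` through `toEnd ξ` alone, without a
decomposition into generators. -/
theorem metric_act (ξ : T.OrthGen) (z w : V) :
    T.metric (T.act ξ z) w =
      2⁻¹ * (T.metric (T.toEnd ξ z) w - T.metric z (T.toEnd ξ w)) +
      8⁻¹ * (LinearMap.trace F V (T.toEnd ξ ∘ₗ T.mul z ∘ₗ T.mul w) -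
        LinearMap.trace F V (T.toEnd ξ ∘ₗ T.mul w ∘ₗ T.mul z)) := by
  have htr : ∀ x y (A : Module.End F V),
      LinearMap.trace F V ((T.metric y).smulRight x ∘ₗ A) = T.metric y (A x) := by
    intro x y A
    have : (T.metric y).smulRight x ∘ₗ A = (T.metric y ∘ₗ A).smulRight x := by ext; simp
    rw [this, LinearMap.trace_smulRight, LinearMap.comp_apply]
  induction ξ using orthGen_induction with
  | gen s x hx y hy =>
    rw [T.act_orth hx hy, T.toEnd_orth hx hy, htr, htr, T.metric_box, LinearMap.comp_apply,
      LinearMap.comp_apply, T.metric_mul_right z y, T.metric_mul_right w y, T.mul_comm z y, T.mul_comm w x,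
      T.mul_comm w y, T.mul_comm z x, T.metric_symm (T.mul x z)]
    simp only [LinearMap.smulRight_apply, map_smul, LinearMap.smul_apply, smul_eq_mul,
      T.metric_symm z x]
    ring
  | add a b ha hb =>
    simp only [map_add, LinearMap.add_apply, LinearMap.add_comp, ha, hb]
    ring

variable {n : ℕ} (hn : ∀ s, Module.finrank F (T.space s) = n)

include hn

theorem trace_proj (s : Fin 3) :
    LinearMap.trace F V ((T.space s).subtype ∘ₗ T.proj s) = n := by
  rw [LinearMap.trace_comp_comm', ← hn s, ← LinearMap.trace_id]
  congr 1
  ext1 x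
  exact T.proj_coe s x

/-- The anticommutator of the two multiplications is 2g(a,b) on the two other summands and zero on
the `s`-th, so its trace is 4n g(a,b). -/
theorem trace_mul_mul (hF : (2 : F) ≠ 0) {s : Fin 3} {a b : V} (ha : a ∈ T.space s)
    (hb : b ∈ T.space s) :
    LinearMap.trace F V (T.mul a ∘ₗ T.mul b) = 2 * n * T.metric a b := by
  have h : T.mul a ∘ₗ T.mul b + T.mul b ∘ₗ T.mul a =
      (2 * T.metric a b) • (LinearMap.id - (T.space s).subtype ∘ₗ T.proj s) := by
    refine T.hom_ext fun t z hz => ?_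
    by_cases hst : s = t
    · subst hst
      simp [T.mul_eq_zero ha hz, T.mul_eq_zero hb hz, T.proj_of_mem hz]
    · simp [T.mul_mul_add hst ha hb hz, T.proj_of_mem_ne (Ne.symm hst) hz]
  have hid : LinearMap.trace F V LinearMap.id = 3 * n := by
    rw [← T.sum_proj, map_sum, Finset.sum_congr rfl fun s _ => T.trace_proj hn s]
    simp
  have h' := congrArg (LinearMap.trace F V) h
  rw [map_add, LinearMap.trace_comp_comm' (T.mul a), map_smul, map_sub, hid, T.trace_proj hn,
    smul_eq_mul] at h'
  refine mul_left_cancel₀ hF ?_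
  linear_combination h'

/-- For D ∈ 𝔗 the metric part of `metric_act` gives g(Dz, w) and the trace part (n/4) g(Dz, w). -/
theorem act_eq_smul_toEnd (hF : (2 : F) ≠ 0) {ξ : T.OrthGen} (hξ : T.toEnd ξ ∈ T.algebra) :
    (4 : F) • T.act ξ = (n + 4 : F) • T.toEnd ξ := by
  have h4 : (4 : F) ≠ 0 := by
    have : (4 : F) = 2 * 2 := by norm_num
    rw [this]
    exact mul_ne_zero hF hF
  have h2 : (2⁻¹ : F) * 2 = 1 := inv_mul_cancel₀ hF
  have h8 : (8⁻¹ : F) * 8 = 1 := by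
    have : (8 : F) = 2 * 4 := by norm_num
    rw [this]
    exact inv_mul_cancel₀ (mul_ne_zero hF h4)
  refine T.hom_ext fun s z hz => T.eq_of_metric fun w => ?_
  refine LinearMap.congr_fun (T.hom_ext (f := T.metric (((4 : F) • T.act ξ) z))
    (h := T.metric (((n + 4 : F) • T.toEnd ξ) z)) fun t w hw => ?_) w
  have hact := (T.act_mem_algebra hF ξ).1 s z hz
  set D := T.toEnd ξ with hD
  simp only [LinearMap.smul_apply, map_smul, smul_eq_mul]
  by_cases hst : s = t
  · subst hst
    -- Taking adjoints reverses the composite: multiplications are symmetric and `D` is skew.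
    have hskew : LinearMap.trace F V (D ∘ₗ T.mul w ∘ₗ T.mul z) =
        -LinearMap.trace F V (D ∘ₗ T.mul z ∘ₗ T.mul w) := by
      rw [LinearMap.trace_comp_comm' (T.mul w ∘ₗ T.mul z), ← map_neg]
      refine LinearMap.BilinForm.trace_eq_of_adjoint T.metric_nondegenerate fun x y => ?_
      simp only [LinearMap.comp_apply, LinearMap.neg_apply, map_neg]
      rw [← T.metric_mul_right, ← T.metric_mul_right, T.metric_apply hξ]
    -- The derivation property gives a second relation between the two traces; with `hskew` it
    -- determines both.
    have hder : D ∘ₗ T.mul z ∘ₗ T.mul w = T.mul (D z) ∘ₗ T.mul w + (T.mul z ∘ₗ D) ∘ₗ T.mul w := by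
      ext v
      simp [T.apply_mul hξ]
    have htr := congrArg (LinearMap.trace F V) hder
    rw [map_add, T.trace_mul_mul hn hF (hξ.1 s z hz) hw, LinearMap.comp_assoc,
      LinearMap.trace_comp_comm' (D ∘ₗ T.mul w), LinearMap.comp_assoc, hskew] at htr
    have ht : LinearMap.trace F V (D ∘ₗ T.mul z ∘ₗ T.mul w) = n * T.metric (D z) w :=
      mul_left_cancel₀ hF (by linear_combination htr)
    rw [T.metric_act, ← hD, hskew, ht]
    linear_combination 4 * T.metric (D z) w * h2 + n * T.metric (D z) w * h8 -
      4 * 2⁻¹ * T.metric_apply hξ z w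
  · rw [T.space_orthogonal s t hst _ hact w hw, T.space_orthogonal s t hst _ (hξ.1 s z hz) w hw]
    simp

end Trace

end Triality

/-! ### The dimension of 𝔗 and the kernel of the action -/

namespace Triality

variable {F V W : Type*} [Field F] [AddCommGroup V] [Module F V] [FiniteDimensional F V]
  [AddCommGroup W] [Module F W] [FiniteDimensional F W]

section CharZero

variable (T : Triality F V)

/-- The orthogonal generator attached to an endomorphism by means of the metric. -/
noncomputable def ofEnd : Module.End F V →ₗ[F] T.OrthGen where
  toFun D := ∑ i, T.orth (D (LinearMap.BilinForm.dualBasis T.metric T.metric_nondegenerate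
    (Module.finBasis F V) i)) (Module.finBasis F V i)
  map_add' D E := by simp [Finset.sum_add_distrib]
  map_smul' c D := by simp [Finset.smul_sum]

theorem toEnd_orth_apply {s : Fin 3} {z : V} (hz : z ∈ T.space s) (x y : V) :
    T.toEnd (T.orth x y) z = T.metric y z • (T.proj s x : V) := by
  refine LinearMap.congr_fun₂ (f := T.orth.compr₂ ((LinearMap.applyₗ z) ∘ₗ T.toEnd))
    (g := ((LinearMap.lsmul F V ∘ₗ T.metric.flip z).flip ∘ₗ (T.space s).subtype ∘ₗ T.proj s))
    (T.hom_ext fun t x hx => T.hom_ext fun r y hy => ?_) x y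
  change T.toEnd (T.orth x y) z = T.metric y z • (T.proj s x : V)
  by_cases htr : t = r
  · subst htr
    rw [T.toEnd_orth hx hy, LinearMap.smulRight_apply]
    by_cases hts : t = s
    · subst hts
      rw [T.proj_of_mem hx]
    · rw [T.space_orthogonal t s hts y hy z hz, zero_smul, zero_smul]
  · rw [T.orth_of_mem_ne htr hx hy, map_zero, LinearMap.zero_apply]
    by_cases hrs : r = s
    · subst hrs
      rw [T.proj_of_mem_ne htr hx, Submodule.coe_zero, smul_zero]
    · rw [T.space_orthogonal r s hrs y hy z hz, zero_smul]

theorem toEnd_ofEnd {D : Module.End F V} (hD : ∀ s, ∀ x ∈ T.space s, D x ∈ T.space s) :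
    T.toEnd (T.ofEnd D) = D := by
  refine T.hom_ext fun s z hz => ?_
  have hsum := (LinearMap.BilinForm.dualBasis T.metric T.metric_nondegenerate
    (Module.finBasis F V)).sum_repr z
  have hDz : (T.proj s (D z) : V) = D z := by rw [T.proj_of_mem (hD s z hz)]
  rw [← hDz]
  conv_rhs => rw [← hsum]
  simp only [ofEnd, LinearMap.coe_mk, AddHom.coe_mk, map_sum, LinearMap.sum_apply,
    T.toEnd_orth_apply hz, map_smul, LinearMap.BilinForm.dualBasis_repr_apply,
    Submodule.coe_sum, Submodule.coe_smul, T.metric_symm z]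

theorem ofEnd_smulRight (x y : V) : T.ofEnd ((T.metric y).smulRight x) = T.orth x y := by
  have hy : y = ∑ i, T.metric y (LinearMap.BilinForm.dualBasis T.metric T.metric_nondegenerate
    (Module.finBasis F V) i) • Module.finBasis F V i := by
    refine T.eq_of_metric fun z => ?_
    refine LinearMap.congr_fun ((LinearMap.BilinForm.dualBasis T.metric T.metric_nondegenerate
      (Module.finBasis F V)).ext fun j => ?_) z
    have hsym : LinearMap.BilinForm.IsSymm T.metric := ⟨fun x y => T.metric_symm x y⟩
    rw [map_sum, LinearMap.sum_apply]
    simp [LinearMap.BilinForm.apply_dualBasis_right _ hsym]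
  conv_rhs => rw [hy]
  simp [ofEnd]

theorem ofEnd_apply_eq_zero {D : Module.End F V} {s : Fin 3} (h : T.proj s ∘ₗ D = 0) :
    T.ofEnd D s = 0 := by
  have h' : ∀ v, T.proj s (D v) = 0 := fun v => LinearMap.congr_fun h v
  rw [ofEnd]
  simp only [LinearMap.coe_mk, AddHom.coe_mk, Finset.sum_apply]
  refine Finset.sum_eq_zero fun i _ => ?_
  simp [orth, h', LinearMap.sum_apply, Finset.sum_apply]

/-- The product part of the box vanishes on the `s`-th summand and preserves the others, so it does
not reach this component; what remains is the skew-symmetrizer. -/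
theorem ofEnd_box {s : Fin 3} {x y : V} (hx : x ∈ T.space s) (hy : y ∈ T.space s) :
    T.ofEnd (T.box x y) s = (2⁻¹ : F) • (T.orth x y - T.orth y x) s := by
  have h : T.box x y = (2⁻¹ : F) • ((T.metric y).smulRight x - (T.metric x).smulRight y) +
      (8⁻¹ : F) • (T.mul x ∘ₗ T.mul y - T.mul y ∘ₗ T.mul x) := rfl
  have h0 : T.proj s ∘ₗ (T.mul x ∘ₗ T.mul y - T.mul y ∘ₗ T.mul x) = 0 := by
    refine T.hom_ext fun t z hz => ?_
    by_cases hst : s = t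
    · subst hst
      simp [T.mul_eq_zero hx hz, T.mul_eq_zero hy hz]
    · obtain ⟨u, hsu, htu⟩ := Fin.exists_third hst
      simp [T.proj_of_mem_ne (Ne.symm hst)
          (T.mul_mem hst htu.symm hx (T.mul_mem hsu htu hy hz)),
        T.proj_of_mem_ne (Ne.symm hst)
          (T.mul_mem hst htu.symm hy (T.mul_mem hsu htu hx hz))]
  rw [h, map_add, map_smul, map_sub, map_smul, ofEnd_smulRight, ofEnd_smulRight, Pi.add_apply,
    Pi.smul_apply, Pi.smul_apply, T.ofEnd_apply_eq_zero h0, smul_zero, add_zero]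

variable {n : ℕ} (hn : ∀ s, Module.finrank F (T.space s) = n)

include hn

theorem four_smul_act_ofEnd (hF : (2 : F) ≠ 0) {D : Module.End F V} (hD : D ∈ T.algebra) :
    (4 : F) • T.act (T.ofEnd D) = (n + 4 : F) • D := by
  have h := T.toEnd_ofEnd hD.1
  rw [T.act_eq_smul_toEnd hn hF (by rwa [h]), h]

/-- Each diagonal block is half of identity minus flip, and the flip of a tensor square has trace n.
-/
theorem trace_ofEnd_act :
    LinearMap.trace F T.OrthGen (T.ofEnd ∘ₗ T.act) = 3 * (2⁻¹ * (n * n - n)) := by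
  have hb : ∀ s, LinearMap.proj s ∘ₗ (T.ofEnd ∘ₗ T.act) ∘ₗ
      LinearMap.single F (fun s => T.space s ⊗[F] T.space s) s =
      (2⁻¹ : F) • (LinearMap.id - (TensorProduct.comm F (T.space s) (T.space s)).toLinearMap) := by
    intro s
    refine TensorProduct.ext' fun x y => ?_
    have h1 : LinearMap.single F (fun s => T.space s ⊗[F] T.space s) s (x ⊗ₜ y) =
        T.orth x y := by
      rw [T.orth_of_mem x.2 y.2]; rfl
    simp only [LinearMap.comp_apply, h1, T.act_orth x.2 y.2, LinearMap.proj_apply,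
      T.ofEnd_box x.2 y.2]
    simp [T.orth_of_mem x.2 y.2, T.orth_of_mem y.2 x.2]
  have ht : ∀ s, LinearMap.trace F (T.space s ⊗[F] T.space s) (LinearMap.proj s ∘ₗ
      (T.ofEnd ∘ₗ T.act) ∘ₗ LinearMap.single F (fun s => T.space s ⊗[F] T.space s) s) =
      2⁻¹ * (n * n - n) := by
    intro s
    have h := (LinearMap.trace F (T.space s ⊗[F] T.space s)).map_sub LinearMap.id
      (TensorProduct.comm F (T.space s) (T.space s)).toLinearMap
    rw [hb, map_smul]
    refine (congrArg (fun c : F => (2⁻¹ : F) • c) h).trans ?_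
    rw [LinearMap.trace_id, TensorProduct.trace_comm_self,
      Module.finrank_tensorProduct, hn, Nat.cast_mul, smul_eq_mul]
  rw [LinearMap.trace_pi, Finset.sum_congr rfl fun s _ => ht s]
  simp

/-- Trace is cyclic: the composite on O has trace 3n(n - 1)/2, while the opposite composite on 𝔗 is
the scalar (n + 4)/4. -/
theorem finrank_algebra_mul (hF : (2 : F) ≠ 0) :
    ((n : F) + 4) * Module.finrank F T.algebra = 6 * (n * n - n) := by
  let act' : T.OrthGen →ₗ[F] T.algebra :=
    T.act.codRestrict T.algebra.toSubmodule (T.act_mem_algebra hF)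
  have h1 : T.ofEnd ∘ₗ T.act = (T.ofEnd ∘ₗ T.algebra.toSubmodule.subtype) ∘ₗ act' := rfl
  have h2 : (4 : F) • (act' ∘ₗ (T.ofEnd ∘ₗ T.algebra.toSubmodule.subtype)) =
      (n + 4 : F) • LinearMap.id := by
    ext1 D
    exact Subtype.ext (T.four_smul_act_ofEnd hn hF D.2)
  have h3 := congrArg (LinearMap.trace F T.algebra) h2
  rw [map_smul, map_smul, ← LinearMap.trace_comp_comm', ← h1, T.trace_ofEnd_act hn,
    LinearMap.trace_id, smul_eq_mul, smul_eq_mul] at h3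
  have h4 : (2⁻¹ : F) * 2 = 1 := inv_mul_cancel₀ hF
  linear_combination -h3 + 6 * (n * n - n : F) * h4

theorem finrank_algebra_eq_tau [CharZero F] (h : n ∈ ({0, 1, 2, 4, 8} : Set ℕ)) :
    Module.finrank F T.algebra = tau n := by
  have h1 := T.finrank_algebra_mul hn two_ne_zero
  have h2 : (n + 4) * Module.finrank F T.algebra + 6 * n = 6 * (n * n) := by
    -- The term `6 * n` is moved to the left so that the cast to natural numbers needs no
    -- subtraction.
    have : ((n : F) + 4) * Module.finrank F T.algebra + 6 * n = 6 * (n * n) := by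
      linear_combination h1
    exact_mod_cast this
  simp only [Set.mem_insert_iff, Set.mem_singleton_iff] at h
  rcases h with rfl | rfl | rfl | rfl | rfl <;> simp only [tau] <;> omega

theorem act_ofEnd [CharZero F] {D : Module.End F V} (hD : D ∈ T.algebra) :
    T.act ((-8⁻¹ * (4 * (n + 4 : F)⁻¹)) • T.ofEnd D) = -(8⁻¹ : F) • D := by
  have h := T.four_smul_act_ofEnd hn two_ne_zero hD
  have h4 : (n + 4 : F) ≠ 0 := by exact_mod_cast (Nat.succ_ne_zero (n + 3))
  have e : -8⁻¹ * (4 * (n + 4 : F)⁻¹) = (-8⁻¹ * (n + 4 : F)⁻¹) * 4 := by ring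
  rw [map_smul, e, mul_smul, h, smul_smul, mul_assoc, inv_mul_cancel₀ h4, mul_one]

/-- By symmetry (n + 4)⟨D, ξ⟩ = 4⟨act (ofEnd D), ξ⟩ = 4⟨act ξ, ofEnd D⟩ = 0, and n + 4 is
invertible. -/
theorem mem_orthRelations_of_act_eq_zero [CharZero F] {ξ : T.OrthGen} (h : T.act ξ = 0) :
    ξ ∈ T.orthRelations := by
  have h4 : (n + 4 : F) ≠ 0 := by exact_mod_cast (Nat.succ_ne_zero (n + 3))
  refine T.mem_orthRelations_iff.2 fun D hD => ?_
  have h1 := T.four_smul_act_ofEnd hn two_ne_zero hD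
  have h2 := LinearMap.congr_fun (congrArg T.pair h1) ξ
  rw [map_smul, map_smul, LinearMap.smul_apply, LinearMap.smul_apply, T.pair_act_comm, h, map_zero,
    LinearMap.zero_apply, smul_zero] at h2
  exact (smul_eq_zero.1 h2.symm).resolve_left h4

end CharZero

end Triality

/-! ### Dimension of the quotient and embedding of the triality algebras -/

theorem Submodule.finrank_prod_eq {K M N : Type*} [Field K] [AddCommGroup M] [Module K M]
    [AddCommGroup N] [Module K N] [FiniteDimensional K M] [FiniteDimensional K N]
    (p : Submodule K M) (q : Submodule K N) :
    Module.finrank K (p.prod q) = Module.finrank K p + Module.finrank K q := by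
  have hf : Function.Injective (p.subtype.prodMap q.subtype) :=
    Function.Injective.prodMap p.injective_subtype q.injective_subtype
  rw [← Module.finrank_prod, ← LinearMap.finrank_range_of_inj hf, LinearMap.range_prodMap,
    Submodule.range_subtype, Submodule.range_subtype]

namespace Triality

variable {F V W : Type*} [Field F] [AddCommGroup V] [Module F V] [FiniteDimensional F V]
  [AddCommGroup W] [Module F W] [FiniteDimensional F W]

section Main

variable (T : Triality F V) (T' : Triality F W)

theorem finrank_relations : Module.finrank F (T.relations T') =
    Module.finrank F T.orthRelations + Module.finrank F T'.orthRelations := by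
  refine (Submodule.finrank_prod_eq _ _).trans ?_
  refine congrArg _ ((Submodule.finrank_prod_eq _ _).trans ?_)
  rw [finrank_bot, add_zero]

theorem finrank_quotient {n n' : ℕ} (hn : ∀ s, Module.finrank F (T.space s) = n)
    (hn' : ∀ s, Module.finrank F (T'.space s) = n') :
    Module.finrank F (T.Gen T' ⧸ T.relations T') =
      3 * n * n' + Module.finrank F T.algebra + Module.finrank F T'.algebra := by
  have h := (T.relations T').finrank_quotient_add_finrank
  have hU : Module.finrank F (T.TensorGen T') = 3 * n * n' := by
    rw [Module.finrank_pi_fintype]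
    simp [Module.finrank_tensorProduct, hn, hn', mul_assoc]
  rw [finrank_relations, Module.finrank_prod, Module.finrank_prod, hU,
    ← T.finrank_orthRelations_add, ← T'.finrank_orthRelations_add] at h
  omega

variable {T T'}

theorem mkQ_orth_eq_zero_iff {ξ : T.OrthGen} :
    (T.relations T').mkQ (ξ, 0, 0) = 0 ↔ ξ ∈ T.orthRelations := by
  rw [Submodule.mkQ_apply, Submodule.Quotient.mk_eq_zero, mem_relations]
  simp

theorem mkQ_orth'_eq_zero_iff {η : T'.OrthGen} :
    (T.relations T').mkQ (0, η, 0) = 0 ↔ η ∈ T'.orthRelations := by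
  rw [Submodule.mkQ_apply, Submodule.Quotient.mk_eq_zero, mem_relations]
  simp

theorem actOrth_smul (T : Triality F V) (c : F) (P : Module.End F V) (ξ : T.OrthGen) :
    T.actOrth (c • P) ξ = c • T.actOrth P ξ := by
  simp only [actOrth, LinearMap.rTensor_smul, LinearMap.lTensor_smul, ← smul_add,
    LinearMap.smul_comp, LinearMap.comp_smul, LinearMap.smul_apply]

variable (T T') in
theorem actTens_smul (c : F) (P : Module.End F V) (Q : Module.End F W) (X : T.TensorGen T') :
    T.actTens T' (c • P) (c • Q) X = c • T.actTens T' P Q X := by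
  simp only [actTens, LinearMap.rTensor_smul, LinearMap.lTensor_smul, ← smul_add,
    LinearMap.smul_comp, LinearMap.comp_smul, LinearMap.smul_apply]

/-- A linear section of the action of orthogonal generators. -/
theorem exists_orth_section [CharZero F] (T : Triality F V) {n : ℕ}
    (hn : ∀ s, Module.finrank F (T.space s) = n) :
    ∃ σ : T.algebra →ₗ[F] T.OrthGen, ∀ D, (-8 : F) • T.act (σ D) = D.1 := by
  -- The constant inverts κ = -8 together with the scalar (n + 4)/4.
  refine ⟨(-8⁻¹ * (4 * (n + 4 : F)⁻¹)) • T.ofEnd ∘ₗ T.algebra.toSubmodule.subtype, fun D => ?_⟩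
  change (-8 : F) • T.act ((-8⁻¹ * (4 * (n + 4 : F)⁻¹)) • T.ofEnd D.1) = D.1
  rw [T.act_ofEnd hn D.2, smul_smul]
  norm_num

/-- In characteristic zero, a Lie algebra which contains the orthogonal generators modulo the
relations contains the triality algebra. -/
theorem exists_lieHom [CharZero F] (T : Triality F V) {n : ℕ}
    (hn : ∀ s, Module.finrank F (T.space s) = n) {L : Type*} [LieRing L] [LieAlgebra F L]
    (j : T.OrthGen →ₗ[F] L) (hj : ∀ ξ, j ξ = 0 ↔ ξ ∈ T.orthRelations)
    (hbr : ∀ ξ η, ⁅j ξ, j η⁆ = j ((-8 : F) • T.actOrth (T.act ξ) η)) :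
    ∃ ι : T.algebra →ₗ⁅F⁆ L, Function.Injective ι ∧ Set.range ι = Set.range j ∧
      ∀ D, ∃ ξ, ι D = j ξ ∧ (-8 : F) • T.act ξ = D.1 := by
  obtain ⟨σ, hσ⟩ := exists_orth_section T hn
  have h8 : (-8 : F) ≠ 0 := by norm_num
  -- The class of an orthogonal generator depends only on its action, so identities in the image of
  -- `j` can be checked in 𝔗.
  have hker : ∀ ξ η : T.OrthGen, (-8 : F) • T.act ξ = (-8 : F) • T.act η → j ξ = j η := by
    intro ξ η h
    rw [← sub_eq_zero, ← map_sub, hj]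
    exact T.mem_orthRelations_of_act_eq_zero hn
      (by rw [map_sub, smul_right_injective _ h8 h, sub_self])
  refine ⟨{ j ∘ₗ σ with map_lie' := ?_ }, ?_, ?_, fun D => ⟨σ D, rfl, hσ D⟩⟩
  · intro D E
    change j (σ ⁅D, E⁆) = ⁅j (σ D), j (σ E)⁆
    rw [hbr, ← actOrth_smul, hσ D]
    refine hker _ _ ?_
    rw [hσ, T.act_actOrth D.2, ← lie_smul, hσ]
    rfl
  · intro D E h
    change j (σ D) = j (σ E) at h
    rw [← sub_eq_zero, ← map_sub, ← map_sub, hj] at h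
    rw [← sub_eq_zero]
    refine Subtype.ext ?_
    rw [← hσ, T.act_eq_zero_of_mem two_ne_zero h, smul_zero]
    rfl
  · ext a
    constructor
    · rintro ⟨D, rfl⟩
      exact ⟨σ D, rfl⟩
    · rintro ⟨ξ, rfl⟩
      refine ⟨⟨(-8 : F) • T.act ξ, T.algebra.smul_mem _ (T.act_mem_algebra two_ne_zero ξ)⟩, ?_⟩
      exact hker _ _ (hσ _)

end Main

end Triality

theorem mainTheorem1 {F : Type u} [Field F] (hF : (2 : F) ≠ 0)
    {V : Type v} [AddCommGroup V] [Module F V] [FiniteDimensional F V]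
    {W : Type w} [AddCommGroup W] [Module F W] [FiniteDimensional F W]
    (T : Triality F V) (T' : Triality F W) (n n' : ℕ)
    (hn : ∀ s, Module.finrank F (T.space s) = n)
    (hn' : ∀ s, Module.finrank F (T'.space s) = n') :
    -- the bracket is well defined modulo the relations, for every constant `κ`
    (∀ (κ : F), ∀ r ∈ T.relations T', ∀ a : T.Gen T',
      T.bracket T' κ r a ∈ T.relations T' ∧ T.bracket T' κ a r ∈ T.relations T') ∧
    -- the bracket is skew-symmetric modulo the relations, for every constant `κ`
    (∀ (κ : F) (a : T.Gen T'), T.bracket T' κ a a ∈ T.relations T') ∧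
    -- for `κ = -8` it induces a Lie algebra structure on the quotient by the relations
    ∃ (𝔤 : Type (max v w)) (_ : LieRing 𝔤) (_ : LieAlgebra F 𝔤) (π : T.Gen T' →ₗ[F] 𝔤),
      Function.Surjective π ∧
      LinearMap.ker π = T.relations T' ∧
      (∀ a b : T.Gen T', ⁅π a, π b⁆ = π (T.bracket T' (-8) a b)) ∧
      -- the dimension
      Module.finrank F 𝔤 =
        3 * n * n' + Module.finrank F T.algebra + Module.finrank F T'.algebra ∧
      -- in characteristic zero, the two orthogonal parts are the triality algebras, acting
      -- naturally on the tensor sectors, and their dimensions are the numbers `τ`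
      (CharZero F →
        (∃ (ι : T.algebra →ₗ⁅F⁆ 𝔤) (ι' : T'.algebra →ₗ⁅F⁆ 𝔤),
          Function.Injective ι ∧ Function.Injective ι' ∧
          Set.range ι = Set.range (fun ξ : T.OrthGen => π (ξ, 0, 0)) ∧
          Set.range ι' = Set.range (fun η : T'.OrthGen => π (0, η, 0)) ∧
          (∀ (D : T.algebra) (x : V) (u : W),
            ⁅ι D, π (0, 0, T.tens T' x u)⁆ = π (0, 0, T.tens T' (D.1 x) u)) ∧
          (∀ (D : T'.algebra) (x : V) (u : W),
            ⁅ι' D, π (0, 0, T.tens T' x u)⁆ = π (0, 0, T.tens T' x (D.1 u)))) ∧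
        (n ∈ ({0, 1, 2, 4, 8} : Set ℕ) → Module.finrank F T.algebra = tau n) ∧
        (n' ∈ ({0, 1, 2, 4, 8} : Set ℕ) → Module.finrank F T'.algebra = tau n')) := by
  refine ⟨fun κ r hr a => ⟨T.bracket_mem_left T' hF κ hr a, T.bracket_mem_right T' hF κ hr a⟩,
    T.bracket_self_mem T' hF, T.Gen T' ⧸ T.relations T', T.quotLieRing T' hF,
    T.quotLieAlgebra T' hF, (T.relations T').mkQ, Submodule.mkQ_surjective _, Submodule.ker_mkQ _,
    fun a b => rfl, T.finrank_quotient T' hn hn', fun _ =>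
    ⟨?_, T.finrank_algebra_eq_tau hn, T'.finrank_algebra_eq_tau hn'⟩⟩
  let := T.quotLieRing T' hF
  let := T.quotLieAlgebra T' hF
  obtain ⟨ι, hinj, hrange, hact⟩ := Triality.exists_lieHom T hn
    ((T.relations T').mkQ ∘ₗ LinearMap.inl F T.OrthGen (T'.OrthGen × T.TensorGen T'))
    (fun ξ => Triality.mkQ_orth_eq_zero_iff) (fun ξ η => by
      change T.quotBracket T' hF (-8) ((T.relations T').mkQ (ξ, 0, 0))
        ((T.relations T').mkQ (η, 0, 0)) = (T.relations T').mkQ (_, 0, 0)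
      rw [Triality.quotBracket_mkQ, Triality.bracket_orth, Triality.actGen]
      simp)
  obtain ⟨ι', hinj', hrange', hact'⟩ := Triality.exists_lieHom T' hn'
    ((T.relations T').mkQ ∘ₗ LinearMap.inr F T.OrthGen (T'.OrthGen × T.TensorGen T') ∘ₗ
      LinearMap.inl F T'.OrthGen (T.TensorGen T'))
    (fun η => Triality.mkQ_orth'_eq_zero_iff) (fun ξ η => by
      change T.quotBracket T' hF (-8) ((T.relations T').mkQ (0, ξ, 0))
        ((T.relations T').mkQ (0, η, 0)) = (T.relations T').mkQ (0, _, 0)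
      rw [Triality.quotBracket_mkQ, Triality.bracket_orth, Triality.actGen]
      simp)
  refine ⟨ι, ι', hinj, hinj', hrange, hrange', fun D x u => ?_, fun D x u => ?_⟩
  · obtain ⟨ξ, h1, h2⟩ := hact D
    rw [h1]
    change T.quotBracket T' hF (-8) ((T.relations T').mkQ (ξ, 0, 0))
      ((T.relations T').mkQ (0, 0, _)) = _
    -- The factor κ = -8 is absorbed into the action of `ξ`, which then becomes `D` itself.
    have h := T.actTens_smul T' (-8) (T.act ξ) 0 (T.tens T' x u)
    rw [h2, smul_zero, T.actTens_tens_of_preserves T' D.2.1 (by simp)] at h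
    rw [Triality.quotBracket_mkQ, Triality.bracket_orth, Triality.actGen]
    simp [← h]
  · obtain ⟨ξ, h1, h2⟩ := hact' D
    rw [h1]
    change T.quotBracket T' hF (-8) ((T.relations T').mkQ (0, ξ, 0))
      ((T.relations T').mkQ (0, 0, _)) = _
    have h := T.actTens_smul T' (-8) 0 (T'.act ξ) (T.tens T' x u)
    rw [h2, smul_zero, T.actTens_tens_of_preserves T' (by simp) D.2.1] at h
    rw [Triality.quotBracket_mkQ, Triality.bracket_orth, Triality.actGen]
    simp [← h]
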